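/- **Theorem 9.2.** Notation: $\tau,z,z_1,z_2,t,v\in\mathbb C$ with $\operatorname{Im}\tau>0$, $q^s=e^{2\pi i\tau s}$, and $\eta(\tau)=q^{1/24}\prod_{n\ge1}(1-q^n)$. For integers $k\ge1$ and $j$ let $$\Theta_{j,k}(\tau,z)=\sum_{n\in\mathbb Z+\frac{j}{2k}}q^{kn^2}e^{2\pi i knz},$$ $$\vartheta_{00}=\Theta_{2,2}+\Theta_{0,2},\quad \vartheta_{01}=-\Theta_{2,2}+\Theta_{0,2},\quad \vartheta_{10}=\Theta_{1,2}+\Theta_{-1,2},\quad \vartheta_{11}=i\Theta_{1,2}-i\Theta_{-1,2}.$$ For an integer $m\ge 0$ let $$\Phi^{[m]}(\tau,z_1,z_2,t)=e^{2\pi i(m+1)t}\sum_{j\in\mathbb Z}\left(\frac{e^{2\pi ij(m+1)(z_1+z_2)}q^{j^2(m+1)}}{1-e^{2\pi iz_1}q^j}-\frac{e^{-2\pi ij(m+1)(z_1+z_2)}q^{j^2(m+1)}}{1-e^{-2\pi iz_2}q^j}\right).$$ With $E(x)=2\int_0^xe^{-\pi u^2}du$ let, for integers $m\ge 1$ and $j$,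 $$R_{m;j}(\tau,v)=\sum_{n\equiv j\bmod 2m}\left(\operatorname{sign}\left(n+\tfrac12\right)-E\left(\left(n+2m\tfrac{\operatorname{Im}v}{\operatorname{Im}\tau}\right)\sqrt{\tfrac{\operatorname{Im}\tau}{m}}\right)\right)e^{-\frac{\pi in^2}{2m}\tau-2\pi inv},$$ and for $m\ge 0$ let $\tilde\Phi^{[m]}=\Phi^{[m]}+\Phi^{[m]}_{\mathrm{add}}$, where $$\Phi^{[m]}_{\mathrm{add}}(\tau,z_1,z_2,t)=-\tfrac12e^{2\pi i(m+1)t}\sum_{j\in\mathbb Z/(2m+2)\mathbb Z}R_{m+1;j}\left(\tau,\tfrac{z_1-z_2}{2}\right)\left(\Theta_{j,m+1}-\Theta_{-j,m+1}\right)(\tau,z_1+z_2).$$ For an integer $M\ge1$, $\epsilon,\epsilon'\in\{0,\frac12\}$ and $j,k\in\epsilon'+\mathbb Z$ let $$\tilde\Psi^{[M,m;\epsilon]}_{j,k;\epsilon'}(\tau,z_1,z_2,t)=q^{\frac{(m+1)jk}{M}}e^{\frac{2\pi i(m+1)}{M}(kz_1+jz_2)}\,\tilde\Phi^{[m]}\left(M\tau,\,z_1+j\tau+\epsilon,\,z_2+k\tau+\epsilon,\,\tfrac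 tM\right).$$ The normalized $N=2$ superconformal denominators ($\epsilon=\frac12$) and superdenominators ($\epsilon=0$) in the Neveu–Schwarz ($\epsilon'=\frac12$) and Ramond ($\epsilon'=0$) sectors are $$\overset{\circ}{R}{}^{(\epsilon)}_{\epsilon'}(\tau,z)=(-1)^{(1-2\epsilon)(1-2\epsilon')}\frac{\eta(\tau)^3}{\vartheta_{1-2\epsilon',\,1-2\epsilon}(\tau,z)},$$ and the modified normalized $N=2$ characters ($\epsilon=\frac12$) and supercharacters ($\epsilon=0$) are defined by $$\widetilde{ch}^{N=2[M,m;\epsilon]}_{j,k;\epsilon'}(\tau,z)=\frac{\tilde\Psi^{[M,m;\epsilon]}_{j,k;\epsilon'}(\tau,-z,z,0)}{\overset{\circ}{R}{}^{(\epsilon)}_{\epsilon'}(\tau,z)}\qquad\text{for } z\notin\epsilon+\epsilon'\tau+\mathbb Z+\mathbb Z\tau .$$ Let $M\ge2$ and $m\ge0$ be integers such that $\gcd(M,2m+2)=1$ if $m>0$, let $c_{M,m}=3\left(1-\frac{2m+2}{M}\right)$, and let $\Omega^{(M)}_\epsilon=\{(j,k)\in(\epsilon+\mathbb Z_{\ge0})^2\mid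 j+k\le M-1,\ j>0\}$. Let $\epsilon,\epsilon'\in\{0,\frac12\}$, $(j,k)\in\Omega^{(M)}_{\epsilon'}$ and $\operatorname{Im}\tau>0$. Then (S) for all $z\notin\epsilon'+\epsilon\tau+\mathbb Z+\mathbb Z\tau$, $$\widetilde{ch}^{N=2[M,m;\epsilon]}_{j,k;\epsilon'}\left(-\tfrac1\tau,\tfrac z\tau\right)=e^{\frac{\pi ic_{M,m}}{3\tau}z^2}\sum_{(a,b)\in\Omega^{(M)}_\epsilon}S^{[M,m,\epsilon,\epsilon']}_{(j,k),(a,b)}\,\widetilde{ch}^{N=2[M,m;\epsilon']}_{a,b;\epsilon}(\tau,z),$$ where $$S^{[M,m,\epsilon,\epsilon']}_{(j,k),(a,b)}=(-i)^{(1-2\epsilon)(1-2\epsilon')}\frac2M\,e^{\frac{\pi i(m+1)}{M}(j-k)(a-b)}\sin\left(\frac{m+1}{M}(j+k)(a+b)\pi\right);$$ (T) for all $z\notin(\epsilon+\epsilon')+\epsilon'\tau+\mathbb Z+\mathbb Z\tau$, $$\widetilde{ch}^{N=2[M,m;\epsilon]}_{j,k;\epsilon'}(\tau+1,z)=e^{\frac{2\pi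 i(m+1)}{M}jk-\frac{\pi i\epsilon'}{2}}\;\widetilde{ch}^{N=2[M,m;\epsilon+\epsilon']}_{j,k;\epsilon'}(\tau,z),$$ where the superscript $\epsilon+\epsilon'$ is read modulo $1$. -/

import Mathlib

namespace N2Characters

noncomputable section

/-- `qpow τ s` is `q ^ s` for `q = e^{2πiτ}`, i.e. `e^{2πiτs}`. -/
def qpow (τ s : ℂ) : ℂ := Complex.exp (2 * Real.pi * Complex.I * τ * s)

/-- `ee x = e^{2πix}`. -/
def ee (x : ℂ) : ℂ := Complex.exp (2 * Real.pi * Complex.I * x)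

/-- The parameters `ε, ε' ∈ {0, 1/2}` are encoded by `e : Fin 2`, with `ε = half e = e / 2`.
Addition in `Fin 2` is then addition of the parameters modulo `1`, and `1 - e` encodes
`1/2 - ε`, so that `1 - 2ε` is the natural number `(1 - e).val`. -/
def half (e : Fin 2) : ℚ := (e.val : ℚ) / 2

/-- The Appell function `Φ^{[m]}(τ, z₁, z₂, t)`. -/
def Phi (m : ℕ) (τ z₁ z₂ t : ℂ) : ℂ :=
  ee ((m + 1) * t) * ∑' j : ℤ,
    (ee (j * (m + 1) * (z₁ + z₂)) * qpow τ (j ^ 2 * (m + 1)) / (1 - ee z₁ * qpow τ j)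
      - ee (-(j * (m + 1) * (z₁ + z₂))) * qpow τ (j ^ 2 * (m + 1)) / (1 - ee (-z₂) * qpow τ j))

/-- The theta function `Θ_{j,k}(τ, z)` of degree `k`: the sum over `x ∈ ℤ + j/(2k)` of
`q^{k x²} e^{2πi k x z}`. -/
def Theta (j : ℤ) (k : ℕ) (τ z : ℂ) : ℂ :=
  ∑' n : ℤ, qpow τ (k * (n + j / (2 * k)) ^ 2) * ee (k * (n + j / (2 * k)) * z)

/-- `E(x) = 2 ∫_0^x e^{-πu²} du` for real `x`. -/
def E (x : ℝ) : ℝ := 2 * ∫ u in (0 : ℝ)..x, Real.exp (-(Real.pi * u ^ 2))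

/-- The summand, at the integer `n`, of Zwegers' function `R_{m;j}(τ, v)`. -/
def zwegersTerm (m : ℕ) (τ v : ℂ) (n : ℤ) : ℂ :=
  ((Real.sign ((n : ℝ) + 1 / 2)
      - E (((n : ℝ) + 2 * m * (v.im / τ.im)) * Real.sqrt (τ.im / m)) : ℝ) : ℂ)
    * Complex.exp (-(Real.pi * Complex.I * n ^ 2 / (2 * m) * τ) - 2 * Real.pi * Complex.I * n * v)

/-- Zwegers' function `R_{m;j}(τ, v)`, for `m ≥ 1`: the sum over the integers
`n ≡ j mod 2m`, written as `n = j + 2ml` with `l ∈ ℤ`. -/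
def zwegersR (m : ℕ) (j : ℤ) (τ v : ℂ) : ℂ :=
  ∑' l : ℤ, zwegersTerm m τ v (j + 2 * m * l)

/-- The correction `Φ^{[m]}_add`. The summand depends on `j` modulo `2m + 2` only, and
`j` runs through the representatives `0, …, 2m + 1`. -/
def PhiAdd (m : ℕ) (τ z₁ z₂ t : ℂ) : ℂ :=
  -(1 / 2) * ee ((m + 1) * t) * ∑ j ∈ Finset.range (2 * m + 2),
    zwegersR (m + 1) j τ ((z₁ - z₂) / 2)
      * (Theta j (m + 1) τ (z₁ + z₂) - Theta (-j) (m + 1) τ (z₁ + z₂))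

/-- The modification of `Φ^{[m]}`. -/
def PhiTilde (m : ℕ) (τ z₁ z₂ t : ℂ) : ℂ := Phi m τ z₁ z₂ t + PhiAdd m τ z₁ z₂ t

/-- The modified numerator: `Ψ^{[M,m;ε]}_{j,k;ε'}` with `Φ^{[m]}` replaced by its modification.
The parameter `ε'` enters only through the condition `j, k ∈ ε' + ℤ`. -/
def PsiTilde (M m : ℕ) (e : Fin 2) (j k : ℚ) (τ z₁ z₂ t : ℂ) : ℂ :=
  qpow τ ((m + 1) * j * k / M) * ee ((m + 1) / M * (k * z₁ + j * z₂))
    * PhiTilde m (M * τ) (z₁ + j * τ + half e) (z₂ + k * τ + half e) (t / M)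

/-- The four Jacobi theta functions `ϑ_{ab}`, `a, b ∈ {0, 1}`. -/
def jacobi : Fin 2 → Fin 2 → ℂ → ℂ → ℂ
  | 0, 0, τ, z => Theta 2 2 τ z + Theta 0 2 τ z
  | 0, 1, τ, z => -Theta 2 2 τ z + Theta 0 2 τ z
  | 1, 0, τ, z => Theta 1 2 τ z + Theta (-1) 2 τ z
  | 1, 1, τ, z => Complex.I * Theta 1 2 τ z - Complex.I * Theta (-1) 2 τ z

/-- The normalized `N = 2` denominator (`e = 1`) or superdenominator (`e = 0`), in the
Neveu-Schwarz (`e' = 1`) or Ramond (`e' = 0`) sector: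
`(-1)^{(1-2ε)(1-2ε')} η(τ)³ / ϑ_{1-2ε',1-2ε}(τ, z)`. -/
def denom (e e' : Fin 2) (τ z : ℂ) : ℂ :=
  (-1) ^ ((1 - e).val * (1 - e').val) * ModularForm.eta τ ^ 3 / jacobi (1 - e') (1 - e) τ z

/-- The modified normalized `N = 2` character (`e = 1`) or supercharacter (`e = 0`) with label
`(j, k)`, in the Neveu-Schwarz (`e' = 1`) or Ramond (`e' = 0`) sector. -/
def chTilde (M m : ℕ) (e e' : Fin 2) (j k : ℚ) (τ z : ℂ) : ℂ :=
  PsiTilde M m e j k τ (-z) z 0 / denom e e' τ z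

/-- `z ∉ ε + ε'τ + ℤ + ℤτ`: the point `(τ, z)` is neither a pole of the numerators
`PsiTilde M m e j k τ (-z) z 0`, `j, k ∈ ε' + ℤ`, nor a pole of `denom e e'`. -/
def IsRegular (e e' : Fin 2) (τ z : ℂ) : Prop :=
  ∀ a b : ℤ, z ≠ half e + half e' * τ + a + b * τ

/-- The index set `Ω^{(M)}_ε` of all `(j, k) ∈ (ε + ℤ_{≥0})²` with `j + k ≤ M - 1` and `j > 0`. -/
def Omega (M : ℕ) (e : Fin 2) : Finset (ℚ × ℚ) :=
  ((Finset.range M ×ˢ Finset.range M).image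
      fun p : ℕ × ℕ => ((half e + p.1, half e + p.2) : ℚ × ℚ)).filter
    fun p => p.1 + p.2 ≤ (M : ℚ) - 1 ∧ 0 < p.1

theorem mem_Omega (M : ℕ) (e : Fin 2) (p : ℚ × ℚ) :
    p ∈ Omega M e ↔ (∃ a b : ℕ, p.1 = half e + a ∧ p.2 = half e + b)
      ∧ p.1 + p.2 ≤ (M : ℚ) - 1 ∧ 0 < p.1 := by
  obtain ⟨x, y⟩ := p
  have h0 : (0 : ℚ) ≤ half e := by unfold half; positivity
  simp only [Omega, Finset.mem_filter, Finset.mem_image, Finset.mem_product, Finset.mem_range,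
    Prod.exists, Prod.mk.injEq]
  constructor
  · rintro ⟨⟨a, b, -, rfl, rfl⟩, h⟩
    exact ⟨⟨a, b, rfl, rfl⟩, h⟩
  · rintro ⟨⟨a, b, rfl, rfl⟩, h⟩
    refine ⟨⟨a, b, ?_, rfl, rfl⟩, h⟩
    have h1 := h.1
    have ha : (0 : ℚ) ≤ a := a.cast_nonneg
    have hb : (0 : ℚ) ≤ b := b.cast_nonneg
    constructor
    · have : (a : ℚ) < M := by linarith
      exact_mod_cast this
    · have : (b : ℚ) < M := by linarith
      exact_mod_cast this

/-- The central charge `c_{M,m} = 3 (1 - (2m + 2)/M)`. -/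
def centralCharge (M m : ℕ) : ℂ := 3 * (1 - (2 * m + 2) / M)

/-- The entry of the `S`-matrix at `((j, k), (a, b))`. -/
def Smatrix (M m : ℕ) (e e' : Fin 2) (jk ab : ℚ × ℚ) : ℂ :=
  (-Complex.I) ^ ((1 - e).val * (1 - e').val) * (2 / M)
    * Complex.exp (Real.pi * Complex.I * (m + 1) / M * (jk.1 - jk.2) * (ab.1 - ab.2))
    * Complex.sin ((m + 1) / M * (jk.1 + jk.2) * (ab.1 + ab.2) * Real.pi)

end

end N2Characters

namespace N2Characters

noncomputable section

open Real Complex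

/-! Put `n = m + 1`, `w = (z₁ - z₂)/2`, `s = z₁ + z₂`. Although `Phi` is not modular, its completion
is, because it can be rewritten as a Gaussian-regularized sum of simple poles over the whole lattice
`ℤτ + ℤ`, where inversion merely permutes the terms.

The building block is `kernel`: the geometric series `1/(1 - e^{2πiζ})` completed by error functions
depending on a real parameter `v`. Its `v`-derivative is a Gaussian sum, and Poisson summation turns
this into the derivative of a sum of `e^{...}/(ζ + b)` over `b ∈ ℤ`. The two functions thus differ
by a constant in `v`. Both are multiplied by `e^{2πiζ} ≠ 1` under `v ↦ v + 1/(2n)`, so the constant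
is zero (`kernel_eq_lattice_tsum`). Summing over `l` gives the completed Appell function `appell` as
an absolutely convergent lattice sum, with inversion `appell_S`. `PhiTilde_eq` identifies the
modified `Φ` with `appell(w, s) - appell(w, -s)`, whence `PhiTilde_S`.

In the numerators `Φ` is taken at `Mτ`, so inversion leads to `τ/M`. The division formula
`PhiTilde_div` returns to `Mτ`: one residue mod `M` comes from the summation index, another from
splitting the geometric series, and coprimality of `m + 1` and `M` aligns the latter with
translations by `τ`. This gives a sum over all label pairs mod `M` (`PsiTilde_S`). The numerator is
odd under `(j, k) ↦ (-k, -j)`, so the sum folds onto `Omega` and pairs of exponentials become sines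
(`PsiTilde_S_Omega`). The classical transformations of `η` and the Jacobi theta functions supply the
denominators.

For `τ ↦ τ + 1` every ingredient is periodic up to explicit phases, and no coprimality is involved.
-/

/-! ### The exponential `ee` and convergence of quadratic exponential series -/

theorem ee_add (x y : ℂ) : ee (x + y) = ee x * ee y := by
  rw [ee, mul_add, Complex.exp_add]; rfl

theorem ee_zero : ee 0 = 1 := by simp [ee]

theorem ee_ne_zero (x : ℂ) : ee x ≠ 0 := Complex.exp_ne_zero _

theorem ee_neg (x : ℂ) : ee (-x) = (ee x)⁻¹ := by
  rw [ee, mul_neg, Complex.exp_neg]; rfl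

theorem ee_int (k : ℤ) : ee k = 1 := by
  rw [ee, mul_comm]; exact Complex.exp_int_mul_two_pi_mul_I k

theorem ee_add_int (x : ℂ) (k : ℤ) : ee (x + k) = ee x := by rw [ee_add, ee_int, mul_one]

/-- `ee` only depends on its argument modulo the integers. -/
theorem ee_congr {x y : ℂ} (k : ℤ) (h : x = y + k) : ee x = ee y := by rw [h, ee_add_int]

theorem ee_eq_one_iff (x : ℂ) : ee x = 1 ↔ ∃ k : ℤ, x = k := by
  constructor
  · intro h
    obtain ⟨k, hk⟩ := Complex.exp_eq_one_iff.mp h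
    exact ⟨k, mul_left_cancel₀ Complex.two_pi_I_ne_zero (by rw [hk]; ring)⟩
  · rintro ⟨k, rfl⟩
    exact ee_int k

theorem ee_nat_mul (k : ℕ) (x : ℂ) : ee (k * x) = ee x ^ k := by
  rw [ee, ee, ← Complex.exp_nat_mul]; ring_nf

theorem qpow_eq_ee (τ s : ℂ) : qpow τ s = ee (τ * s) := by
  rw [qpow, ee]; ring_nf

theorem norm_ee (x : ℂ) : ‖ee x‖ = Real.exp (-(2 * π * x.im)) := by
  rw [ee, Complex.norm_exp]
  congr 1
  simp [Complex.mul_re]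

theorem summable_ee_quadratic {α : ℂ} (hα : 0 < α.im) (β γ : ℂ) :
    Summable fun N : ℤ => ee (α * N ^ 2 + β * N + γ) := by
  have h := (summable_jacobiTheta₂_term_iff β (2 * α)).mpr (by simpa using hα)
  refine (h.mul_right (ee γ)).congr fun N => ?_
  rw [jacobiTheta₂_term, ee, ee, ← Complex.exp_add]
  ring_nf

theorem summable_exp_quadratic {a : ℝ} (ha : 0 < a) (b c : ℝ) :
    Summable fun N : ℤ => Real.exp (-(a * (N : ℝ) ^ 2) + b * N + c) := by
  have hp := Real.pi_pos
  have h := (summable_ee_quadratic (α := (a / (2 * π) : ℝ) * I)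
    (by rw [Complex.im_ofReal_mul, Complex.I_im, mul_one]; positivity)
    (-(b / (2 * π) : ℝ) * I) (-(c / (2 * π) : ℝ) * I)).norm
  refine h.congr fun N => ?_
  rw [norm_ee]
  congr 1
  have : ((a / (2 * π) : ℝ) * I * (N : ℂ) ^ 2 + -(b / (2 * π) : ℝ) * I * N
      + -(c / (2 * π) : ℝ) * I)
      = ((a / (2 * π) * N ^ 2 - (b / (2 * π)) * N - c / (2 * π) : ℝ) : ℂ) * I := by
    push_cast; ring
  rw [this, Complex.im_ofReal_mul, Complex.I_im]
  field_simp
  ring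

/-! ### The error function and series weighted by its tails -/

theorem continuous_gaussian : Continuous fun u : ℝ => Real.exp (-(π * u ^ 2)) := by fun_prop

theorem hasDerivAt_E (x : ℝ) : HasDerivAt E (2 * Real.exp (-(π * x ^ 2))) x := by
  have := continuous_gaussian.integral_hasStrictDerivAt (0 : ℝ) x
  exact this.hasDerivAt.const_mul 2

theorem E_neg (x : ℝ) : E (-x) = -E x := by
  have h := intervalIntegral.integral_comp_neg (a := 0) (b := x)
    (fun u : ℝ => Real.exp (-(π * u ^ 2)))
  rw [neg_zero] at h
  rw [E, intervalIntegral.integral_symm, ← h, E]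
  simp

theorem integrable_gaussian : MeasureTheory.Integrable fun u : ℝ => Real.exp (-(π * u ^ 2)) := by
  simpa using integrable_exp_neg_mul_sq Real.pi_pos

theorem one_sub_E (x : ℝ) : 1 - E x = 2 * ∫ u in Set.Ioi x, Real.exp (-(π * u ^ 2)) := by
  have h0 : ∫ u in Set.Ioi (0 : ℝ), Real.exp (-(π * u ^ 2)) = 1 / 2 := by
    have := integral_gaussian_Ioi π
    simpa [Real.pi_ne_zero] using this
  have h1 := intervalIntegral.integral_Ioi_sub_Ioi'
    (integrable_gaussian.integrableOn (s := Set.Ioi (0 : ℝ)))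
    (integrable_gaussian.integrableOn (s := Set.Ioi x))
  rw [E, ← h1, h0]
  ring

/-- Translate the tail integral to `(0, ∞)` and use `(u + x)² ≥ u² + x²` for `u, x ≥ 0`. -/
theorem one_sub_E_le {x : ℝ} (hx : 0 ≤ x) : 1 - E x ≤ Real.exp (-(π * x ^ 2)) := by
  have h0 : ∫ u in Set.Ioi (0 : ℝ), Real.exp (-(π * u ^ 2)) = 1 / 2 := by
    have := integral_gaussian_Ioi π
    simpa [Real.pi_ne_zero] using this
  have h1 : ∫ u in Set.Ioi x, Real.exp (-(π * u ^ 2))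
      = ∫ u in Set.Ioi (0 : ℝ), Real.exp (-(π * (u + x) ^ 2)) := by
    have := (MeasureTheory.measurePreserving_add_right MeasureTheory.volume x).setIntegral_preimage_emb
      (measurableEmbedding_addRight x) (fun u : ℝ => Real.exp (-(π * u ^ 2))) (Set.Ioi x)
    rw [← this]
    simp
  have h2 : ∫ u in Set.Ioi (0 : ℝ), Real.exp (-(π * (u + x) ^ 2))
      ≤ ∫ u in Set.Ioi (0 : ℝ), Real.exp (-(π * x ^ 2)) * Real.exp (-(π * u ^ 2)) := by
    refine MeasureTheory.setIntegral_mono_on ?_ ?_ measurableSet_Ioi fun u hu => ?_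
    · exact (integrable_gaussian.comp_add_right x).integrableOn
    · exact (integrable_gaussian.const_mul _).integrableOn
    · rw [← Real.exp_add, Real.exp_le_exp]
      have : 0 ≤ π * (u * x) := mul_nonneg Real.pi_pos.le (mul_nonneg (Set.mem_Ioi.mp hu).le hx)
      nlinarith
  rw [MeasureTheory.integral_const_mul, h0] at h2
  rw [one_sub_E, h1]
  linarith

theorem E_le_one (x : ℝ) : E x ≤ 1 := by
  have : 0 ≤ 1 - E x := by
    rw [one_sub_E]
    exact mul_nonneg two_pos.le (MeasureTheory.integral_nonneg fun u => (Real.exp_pos _).le)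
  linarith

theorem abs_E_le_one (x : ℝ) : |E x| ≤ 1 := by
  have h1 := E_le_one x
  have h2 := E_le_one (-x)
  rw [E_neg] at h2
  exact abs_le.mpr ⟨by linarith, h1⟩

/-- Gaussian decay of the complementary error function. -/
theorem abs_sign_sub_E_le {σ t : ℝ} (hσ : σ = 1 ∨ σ = -1) (h : 0 ≤ σ * t) :
    |σ - E t| ≤ Real.exp (-(π * t ^ 2)) := by
  rcases hσ with rfl | rfl
  · rw [one_mul] at h
    rw [abs_of_nonneg (by linarith [E_le_one t])]
    exact one_sub_E_le h
  · have h' : 0 ≤ -t := by linarith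
    have h1 := one_sub_E_le h'
    have h2 := E_le_one (-t)
    rw [E_neg] at h1 h2
    rw [neg_sq] at h1
    rw [abs_of_nonpos (by linarith)]
    linarith

theorem sign_int_add {κ : ℝ} (hκ : |κ| = 1 / 2) (N : ℤ) :
    (Real.sign (N + κ) = 1 ∧ 0 < (N : ℝ) + κ) ∨ (Real.sign (N + κ) = -1 ∧ (N : ℝ) + κ < 0) := by
  rcases lt_trichotomy ((N : ℝ) + κ) 0 with h | h | h
  · exact Or.inr ⟨Real.sign_of_neg h, h⟩
  · exfalso
    have hN : |(N : ℝ)| = 1 / 2 := by rw [← hκ, ← abs_neg κ]; congr 1; linarith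
    have h2 : (((2 * |N| : ℤ)) : ℝ) = ((1 : ℤ) : ℝ) := by push_cast; linarith
    have := Int.cast_injective h2
    omega
  · exact Or.inl ⟨Real.sign_of_pos h, h⟩

theorem abs_half : |(1 / 2 : ℝ)| = 1 / 2 := abs_of_pos (by norm_num)

theorem abs_neg_half : |-(1 / 2 : ℝ)| = 1 / 2 := by rw [abs_neg, abs_half]

theorem sq_mul_sqrt_div {n : ℕ} {y : ℝ} (hy : 0 < y) (t : ℝ) :
    (t * √(y / n)) ^ 2 = y / n * t ^ 2 := by
  rw [mul_pow, Real.sq_sqrt (by positivity), mul_comm]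

/-- The tail bound applies when the sign agrees with that of the argument of `E`. A disagreement
forces `|N + 2nv| ≤ 2n|v| + 1`, and there the trivial bound 2 is absorbed into the constant. -/
theorem exists_abs_sign_sub_E_le {κ : ℝ} (hκ : |κ| = 1 / 2) (n : ℕ) {y : ℝ} (hy : 0 < y) (v : ℝ) :
    ∃ C : ℝ, ∀ N : ℤ, |Real.sign (N + κ) - E ((N + 2 * n * v) * √(y / n))|
      ≤ C * Real.exp (-(π * (y / n * (N + 2 * n * v) ^ 2))) := by
  have hyn : 0 ≤ y / n := by positivity
  refine ⟨2 * Real.exp (π * (y / n * (2 * n * |v| + 1) ^ 2)), fun N => ?_⟩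
  have hsq : 0 ≤ √(y / n) := Real.sqrt_nonneg _
  have hσ : Real.sign (N + κ) = 1 ∨ Real.sign (N + κ) = -1 :=
    (sign_int_add hκ N).imp And.left And.left
  by_cases h : 0 ≤ Real.sign (N + κ) * ((N : ℝ) + 2 * n * v)
  · have h1 := abs_sign_sub_E_le hσ (t := (N + 2 * n * v) * √(y / n))
      (by rw [← mul_assoc]; exact mul_nonneg h hsq)
    rw [sq_mul_sqrt_div hy] at h1
    refine h1.trans (le_mul_of_one_le_left (Real.exp_pos _).le ?_)
    have : 1 ≤ Real.exp (π * (y / n * (2 * n * |v| + 1) ^ 2)) :=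
      Real.one_le_exp (by positivity)
    linarith
  · have h2 : |Real.sign (N + κ) - E ((N + 2 * n * v) * √(y / n))| ≤ 2 := by
      refine (abs_sub _ _).trans ?_
      have := abs_E_le_one ((N + 2 * n * v) * √(y / n))
      have hσ1 : |Real.sign (N + κ)| = 1 := by rcases hσ with h | h <;> rw [h] <;> simp
      linarith
    have hκ' := abs_le.mp hκ.le
    have hv := abs_le.mp (le_refl |v|)
    have hn0 : (0 : ℝ) ≤ n := n.cast_nonneg
    have hv1 : (n : ℝ) * v ≤ n * |v| := mul_le_mul_of_nonneg_left hv.2 hn0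
    have hv2 : (n : ℝ) * -|v| ≤ n * v := mul_le_mul_of_nonneg_left hv.1 hn0
    have h3 : ((N : ℝ) + 2 * n * v) ^ 2 ≤ (2 * n * |v| + 1) ^ 2 := by
      apply sq_le_sq'
      · rcases sign_int_add hκ N with ⟨hs, hp⟩ | ⟨hs, hp⟩ <;> rw [hs] at h <;> push Not at h <;>
          linarith
      · rcases sign_int_add hκ N with ⟨hs, hp⟩ | ⟨hs, hp⟩ <;> rw [hs] at h <;> push Not at h <;>
          linarith
    refine h2.trans ?_
    rw [mul_assoc, ← Real.exp_add]
    have : 1 ≤ Real.exp (π * (y / n * (2 * n * |v| + 1) ^ 2)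
        + -(π * (y / n * (N + 2 * n * v) ^ 2))) := by
      refine Real.one_le_exp ?_
      have := mul_le_mul_of_nonneg_left (mul_le_mul_of_nonneg_left h3 hyn) Real.pi_pos.le
      linarith
    linarith

/-- The weight decays like `e^{-π(y/n)N²}` while `|ee (αN²)| = e^{-2π Im α N²}`, so the condition on
`α` is exactly that Gaussian decay survives. Allowing `κ = ±1/2` covers the jump used in `kernel`
and the one in `zwegersR`. -/
theorem summable_sign_sub_E_mul_ee {κ : ℝ} (hκ : |κ| = 1 / 2) (n : ℕ) {y : ℝ} (hy : 0 < y) (v : ℝ)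
    {α : ℂ} (hα : 0 < y / n + 2 * α.im) (β : ℂ) :
    Summable fun N : ℤ => ((Real.sign (N + κ) - E ((N + 2 * n * v) * √(y / n)) : ℝ) : ℂ)
      * ee (α * N ^ 2 + β * N) := by
  obtain ⟨C, hC⟩ := exists_abs_sign_sub_E_le hκ n hy v
  refine Summable.of_norm_bounded ((summable_exp_quadratic (mul_pos Real.pi_pos hα)
    (-(π * (y / n * (4 * n * v))) - 2 * π * β.im) (-(π * (y / n * (2 * n * v) ^ 2)))).mul_left C)
    fun N => ?_
  rw [norm_mul, Complex.norm_real, Real.norm_eq_abs, norm_ee]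
  refine (mul_le_mul_of_nonneg_right (hC N) (Real.exp_pos _).le).trans (le_of_eq ?_)
  rw [mul_assoc, ← Real.exp_add]
  congr 2
  have h1 : (α * (N : ℂ) ^ 2).im = α.im * N ^ 2 := by
    have : ((N : ℂ) ^ 2) = (((N : ℝ) ^ 2 : ℝ) : ℂ) := by push_cast; rfl
    rw [this, Complex.im_mul_ofReal]
  have h2 : (β * (N : ℂ)).im = β.im * N := by
    have : (N : ℂ) = ((N : ℝ) : ℂ) := by push_cast; rfl
    rw [this, Complex.im_mul_ofReal]
  rw [Complex.add_im, h1, h2]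
  ring

/-! ### The completed geometric series -/

/-- The one-variable kernel of the completed Appell function: a geometric series completed
by error functions. -/
def kernel (n : ℕ) (y v : ℝ) (ζ : ℂ) : ℂ :=
  1 / (1 - ee ζ) + 1 / 2 * ∑' N : ℤ,
    ((Real.sign (N + -(1 / 2)) - E ((N + 2 * n * v) * √(y / n)) : ℝ) : ℂ) * ee (-(N * ζ))

theorem summable_kernel {κ : ℝ} (hκ : |κ| = 1 / 2) {n : ℕ} (hn : 0 < n) {y : ℝ} (hy : 0 < y)
    (v : ℝ) (ζ : ℂ) :
    Summable fun N : ℤ => ((Real.sign (N + κ) - E ((N + 2 * n * v) * √(y / n)) : ℝ) : ℂ)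
      * ee (-(N * ζ)) := by
  have hn' : (0 : ℝ) < n := Nat.cast_pos.mpr hn
  refine (summable_sign_sub_E_mul_ee hκ n hy v (α := 0) (by simp; positivity) (-ζ)).congr
    fun N => ?_
  ring_nf

theorem sign_half_sub (N : ℤ) :
    Real.sign ((N : ℝ) + 1 / 2) = Real.sign ((N : ℝ) + -(1 / 2)) + if N = 0 then 2 else 0 := by
  have hc : N ≤ -1 ∨ N = 0 ∨ 1 ≤ N := by omega
  rcases hc with h | rfl | h
  · have : (N : ℝ) ≤ -1 := by exact_mod_cast h
    rw [Real.sign_of_neg (by linarith), Real.sign_of_neg (by linarith), if_neg (by omega)]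
    norm_num
  · rw [Real.sign_of_pos (by norm_num), Real.sign_of_neg (by norm_num)]
    norm_num
  · have : (1 : ℝ) ≤ N := by exact_mod_cast h
    rw [Real.sign_of_pos (by linarith), Real.sign_of_pos (by linarith), if_neg (by omega)]
    norm_num

/-- Moving the jump of the sign function moves one term between the two parts of the kernel. -/
theorem tsum_sign_half {n : ℕ} (hn : 0 < n) {y : ℝ} (hy : 0 < y) (v : ℝ) (ζ : ℂ) :
    ∑' N : ℤ, ((Real.sign (N + 1 / 2) - E ((N + 2 * n * v) * √(y / n)) : ℝ) : ℂ) * ee (-(N * ζ))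
      = ∑' N : ℤ, ((Real.sign (N + -(1 / 2)) - E ((N + 2 * n * v) * √(y / n)) : ℝ) : ℂ)
          * ee (-(N * ζ)) + 2 := by
  have h1 : HasSum (fun N : ℤ => if N = 0 then (2 : ℂ) else 0) 2 := hasSum_ite_eq 0 2
  have h2 := (summable_kernel abs_neg_half hn hy v ζ).hasSum.add h1
  rw [← h2.tsum_eq]
  refine tsum_congr fun N => ?_
  rw [sign_half_sub]
  split_ifs with h
  · subst h
    simp [ee_zero]
    ring
  · simp

/-- Since `1/(1 - x) = x/(1 - x) + 1`, placing the jump at `-1/2` instead of `1/2` is paid for by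
the term `N = 0`. -/
theorem kernel_eq {n : ℕ} (hn : 0 < n) {y : ℝ} (hy : 0 < y) (v : ℝ) {ζ : ℂ} (hζ : ee ζ ≠ 1) :
    kernel n y v ζ = ee ζ / (1 - ee ζ) + 1 / 2 * ∑' N : ℤ,
      ((Real.sign (N + 1 / 2) - E ((N + 2 * n * v) * √(y / n)) : ℝ) : ℂ) * ee (-(N * ζ)) := by
  have : 1 - ee ζ ≠ 0 := sub_ne_zero.mpr (Ne.symm hζ)
  rw [tsum_sign_half hn hy, kernel]
  generalize (∑' N : ℤ, _ : ℂ) = S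
  field_simp
  ring

theorem kernel_add_int (n : ℕ) (y v : ℝ) (ζ : ℂ) (k : ℤ) :
    kernel n y v (ζ + k) = kernel n y v ζ := by
  rw [kernel, kernel, ee_add_int]
  congr 2
  refine tsum_congr fun N => ?_
  congr 1
  exact ee_congr (-(N * k)) (by push_cast; ring)

/-- Shifting `v` by `1/(2n)` is the index shift `N ↦ N - 1` inside `E`. The sign jump then sits one
place off, and the single term so displaced is what the rational part needs to acquire the factor
`ee ζ`. -/
theorem kernel_shift_one {n : ℕ} (hn : 0 < n) {y : ℝ} (hy : 0 < y) (v : ℝ) {ζ : ℂ}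
    (hζ : ee ζ ≠ 1) : kernel n y (v + 1 / (2 * n)) ζ = ee ζ * kernel n y v ζ := by
  have hn' : (n : ℝ) ≠ 0 := Nat.cast_ne_zero.mpr hn.ne'
  rw [kernel_eq hn hy v hζ, kernel, ← (Equiv.subRight (1 : ℤ)).tsum_eq]
  have h1 : 1 - ee ζ ≠ 0 := sub_ne_zero.mpr (Ne.symm hζ)
  have key : ∀ N : ℤ, ((Real.sign (((Equiv.subRight (1 : ℤ)) N : ℤ) + -(1 / 2))
        - E ((((Equiv.subRight (1 : ℤ)) N : ℤ) + 2 * n * (v + 1 / (2 * n))) * √(y / n)) : ℝ) : ℂ)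
        * ee (-(((Equiv.subRight (1 : ℤ)) N : ℤ) * ζ))
      = ee ζ * (((Real.sign (N + -(1 / 2)) - E ((N + 2 * n * v) * √(y / n)) : ℝ) : ℂ)
        * ee (-(N * ζ))) - (if N = 1 then 2 else 0) := by
    intro N
    have e1 : -((((Equiv.subRight (1 : ℤ)) N : ℤ) : ℂ) * ζ) = ζ + -(N * ζ) := by
      simp; ring
    have e2 : ((((Equiv.subRight (1 : ℤ)) N : ℤ) : ℝ) + 2 * n * (v + 1 / (2 * n)))
        = N + 2 * n * v := by
      simp; field_simp; ring
    have e3 := sign_half_sub (N - 1)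
    have e4 : Real.sign ((((Equiv.subRight (1 : ℤ)) N : ℤ) : ℝ) + -(1 / 2))
        = Real.sign ((N : ℝ) + -(1 / 2)) - if N = 1 then 2 else 0 := by
      have : ((N - 1 : ℤ) : ℝ) + 1 / 2 = (N : ℝ) + -(1 / 2) := by push_cast; ring
      rw [this] at e3
      rw [e3]
      simp [sub_eq_zero]
    rw [e1, e2, e4, ee_add]
    split_ifs with h
    · subst h
      have : ee ζ * ee (-((1 : ℤ) * ζ)) = 1 := by rw [← ee_add, ← ee_zero]; congr 1; simp
      push_cast at this ⊢
      linear_combination (-2) * this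
    · push_cast; ring
  rw [tsum_congr key]
  have h2 : HasSum (fun N : ℤ => if N = 1 then (2 : ℂ) else 0) 2 := hasSum_ite_eq 1 2
  have h3 := ((summable_kernel abs_neg_half hn hy v ζ).hasSum.mul_left (ee ζ)).sub h2
  rw [h3.tsum_eq, tsum_sign_half hn hy]
  generalize (∑' N : ℤ, _ : ℂ) = S
  field_simp
  ring

theorem kernel_shift {n : ℕ} (hn : 0 < n) {y : ℝ} (hy : 0 < y) (v : ℝ) {ζ : ℂ}
    (hζ : ee ζ ≠ 1) (c : ℤ) : kernel n y (v + c / (2 * n)) ζ = ee (c * ζ) * kernel n y v ζ := by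
  induction c using Int.induction_on with
  | zero => simp [ee_zero]
  | succ c ih =>
    have := kernel_shift_one hn hy (v + (c : ℤ) / (2 * n)) hζ
    rw [ih] at this
    have e : v + ((c + 1 : ℤ) : ℝ) / (2 * n) = v + (c : ℤ) / (2 * n) + 1 / (2 * n) := by
      push_cast; ring
    rw [e, this, ← mul_assoc, ← ee_add]
    congr 2
    push_cast; ring
  | pred c ih =>
    have := kernel_shift_one hn hy (v + (-c - 1 : ℤ) / (2 * n)) hζ
    have e : v + ((-c - 1 : ℤ) : ℝ) / (2 * n) + 1 / (2 * n) = v + (-c : ℤ) / (2 * n) := by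
      push_cast; ring
    rw [e, ih] at this
    apply mul_left_cancel₀ (ee_ne_zero ζ)
    rw [← this, ← mul_assoc, ← ee_add]
    congr 2
    push_cast; ring

/-! ### The kernel as a sum of simple poles -/

theorem hasDerivAt_error_tsum {n : ℕ} (hn : 0 < n) {y : ℝ} (hy : 0 < y) (ζ : ℂ) (v : ℝ) :
    HasDerivAt (fun v : ℝ => ∑' N : ℤ,
      ((Real.sign (N + -(1 / 2)) - E ((N + 2 * n * v) * √(y / n)) : ℝ) : ℂ) * ee (-(N * ζ)))
      (∑' N : ℤ, ((-(2 * Real.exp (-(π * ((N + 2 * n * v) * √(y / n)) ^ 2))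
        * (2 * n * √(y / n))) : ℝ) : ℂ) * ee (-(N * ζ))) v := by
  have hn' : (0 : ℝ) < n := Nat.cast_pos.mpr hn
  set B : ℝ := |v| + 1
  have hv : v ∈ Set.Ioo (-B) B := by
    have := abs_le.mp (le_refl |v|)
    exact ⟨by simp only [B]; linarith, by simp only [B]; linarith⟩
  refine hasDerivAt_tsum_of_isPreconnected (𝕜 := ℝ) (F := ℂ) (t := Set.Ioo (-B) B) (y₀ := v)
    (g := fun (N : ℤ) (v : ℝ) =>
      ((Real.sign (N + -(1 / 2)) - E ((N + 2 * n * v) * √(y / n)) : ℝ) : ℂ) * ee (-(N * ζ)))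
    (g' := fun (N : ℤ) (v : ℝ) => ((-(2 * Real.exp (-(π * ((N + 2 * n * v) * √(y / n)) ^ 2))
        * (2 * n * √(y / n))) : ℝ) : ℂ) * ee (-(N * ζ)))
    (u := fun N : ℤ => 4 * n * √(y / n) * Real.exp (-(π * (y / n / 2) * (N : ℝ) ^ 2)
      + 2 * π * ζ.im * N + π * (y / n * (2 * n * B) ^ 2)))
    ((summable_exp_quadratic (by positivity) _ _).mul_left _) isOpen_Ioo isPreconnected_Ioo
    (fun N w _ => ?_) (fun N w hw => ?_) hv (summable_kernel abs_neg_half hn hy v ζ) hv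
  · have h1 : HasDerivAt (fun w : ℝ => (N + 2 * n * w) * √(y / n)) (2 * n * √(y / n)) w := by
      have := (((hasDerivAt_id w).const_mul (2 * n : ℝ)).const_add (N : ℝ)).mul_const (√(y / n))
      simpa using this
    have h2 := ((hasDerivAt_E ((N + 2 * n * w) * √(y / n))).comp w h1).const_sub
      (Real.sign (N + -(1 / 2)))
    exact (h2.ofReal_comp).mul_const _
  · rw [norm_mul, Complex.norm_real, Real.norm_eq_abs, abs_neg, norm_ee, abs_of_nonneg
      (by positivity), sq_mul_sqrt_div hy]
    have e : 2 * Real.exp (-(π * (y / n * (N + 2 * n * w) ^ 2))) * (2 * n * √(y / n))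
        * Real.exp (-(2 * π * (-(N * ζ)).im))
        = 4 * n * √(y / n) * Real.exp (-(π * (y / n * (N + 2 * n * w) ^ 2))
          + -(2 * π * (-(N * ζ)).im)) := by
      rw [Real.exp_add]; ring
    rw [e]
    refine mul_le_mul_of_nonneg_left (Real.exp_le_exp.mpr ?_) (by positivity)
    have h1 : (-((N : ℂ) * ζ)).im = -(N * ζ.im) := by simp
    have h2 : (2 * n * w) ^ 2 ≤ (2 * n * B) ^ 2 := by
      rw [mul_pow, mul_pow _ B]
      exact mul_le_mul_of_nonneg_left (sq_le_sq' hw.1.le hw.2.le) (by positivity)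
    -- The inequality with `w` in place of `B` is `(N + 4nw)²/2 ≥ 0`. It gives a Gaussian majorant
    -- in `N` uniform for `|w| < B`.
    have h3 : (N : ℝ) ^ 2 / 2 - (2 * n * B) ^ 2 ≤ (N + 2 * n * w) ^ 2 := by
      nlinarith [sq_nonneg ((N : ℝ) + 4 * n * w)]
    have h4 := mul_le_mul_of_nonneg_left h3 (show 0 ≤ π * (y / n) by positivity)
    rw [h1]
    linarith

theorem norm_ee_two_mul (n : ℕ) (v : ℝ) (ζ : ℂ) (b : ℤ) :
    ‖ee (2 * n * v * (ζ + b))‖ = Real.exp (-(4 * π * n * v * ζ.im)) := by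
  rw [norm_ee]
  have : (2 * n * v * (ζ + b) : ℂ) = ((2 * n * v : ℝ) : ℂ) * (ζ + b) := by push_cast; ring
  rw [this, Complex.im_ofReal_mul]
  congr 1
  simp
  ring

theorem summable_gaussian_shift {n : ℕ} (hn : 0 < n) {y : ℝ} (hy : 0 < y) (ζ : ℂ) :
    Summable fun b : ℤ => ee (I * n / (2 * y) * (ζ + b) ^ 2) := by
  have hn' : (0 : ℝ) < n := Nat.cast_pos.mpr hn
  have hα : 0 < (I * n / (2 * y) : ℂ).im := by
    have : (I * n / (2 * y) : ℂ) = ((n / (2 * y) : ℝ) : ℂ) * I := by push_cast; ring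
    rw [this, Complex.im_ofReal_mul, Complex.I_im]
    positivity
  refine (summable_ee_quadratic hα (2 * (I * n / (2 * y)) * ζ)
    (I * n / (2 * y) * ζ ^ 2)).congr fun b => ?_
  ring_nf

/-- Terms of the lattice form of the kernel. -/
def latticeTerm (n : ℕ) (y v : ℝ) (ζ : ℂ) : ℂ :=
  ee (2 * n * v * ζ + I * n / (2 * y) * ζ ^ 2) / ζ

theorem finite_norm_add_int_lt (ζ : ℂ) : {b : ℤ | ‖ζ + b‖ < 1}.Finite := by
  refine (Set.finite_Icc (-⌈|ζ.re| + 1⌉) (⌈|ζ.re| + 1⌉)).subset fun b hb => ?_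
  have h1 : |ζ.re + b| < 1 := by
    refine lt_of_le_of_lt ?_ hb
    simpa using Complex.abs_re_le_norm (ζ + b)
  have h2 := abs_lt.mp h1
  have h3 := abs_le.mp (le_refl |ζ.re|)
  have h4 := Int.le_ceil (|ζ.re| + 1)
  constructor
  · have : ((-⌈|ζ.re| + 1⌉ : ℤ) : ℝ) ≤ b := by push_cast; linarith
    exact_mod_cast this
  · have : (b : ℝ) ≤ ((⌈|ζ.re| + 1⌉ : ℤ) : ℝ) := by linarith
    exact_mod_cast this

/-- All but finitely many denominators have norm at least 1. The finitely many others are irrelevant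
to summability, even if one of them vanishes. -/
theorem summable_latticeTerm {n : ℕ} (hn : 0 < n) {y : ℝ} (hy : 0 < y) (v : ℝ) (ζ : ℂ) :
    Summable fun b : ℤ => latticeTerm n y v (ζ + b) := by
  refine Summable.of_norm_bounded_eventually
    ((summable_gaussian_shift hn hy ζ).norm.mul_left (Real.exp (-(4 * π * n * v * ζ.im)))) ?_
  filter_upwards [(finite_norm_add_int_lt ζ).compl_mem_cofinite] with b hb
  have hb' : 1 ≤ ‖ζ + b‖ := not_lt.mp hb
  rw [latticeTerm, norm_div, ee_add, norm_mul, norm_ee_two_mul]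
  exact div_le_self (by positivity) hb'

theorem hasDerivAt_lattice_tsum {n : ℕ} (hn : 0 < n) {y : ℝ} (hy : 0 < y) {ζ : ℂ}
    (hζ : ee ζ ≠ 1) (v : ℝ) :
    HasDerivAt (fun v : ℝ => ∑' b : ℤ, latticeTerm n y v (ζ + b))
      (∑' b : ℤ, 2 * π * I * (2 * n)
        * ee (2 * n * v * (ζ + b) + I * n / (2 * y) * (ζ + b) ^ 2)) v := by
  have hn' : (0 : ℝ) < n := Nat.cast_pos.mpr hn
  set B : ℝ := |v| + 1
  have hv : v ∈ Set.Ioo (-B) B := by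
    have := abs_le.mp (le_refl |v|)
    exact ⟨by simp only [B]; linarith, by simp only [B]; linarith⟩
  refine hasDerivAt_tsum_of_isPreconnected (𝕜 := ℝ) (F := ℂ) (t := Set.Ioo (-B) B) (y₀ := v)
    (g := fun (b : ℤ) (v : ℝ) => latticeTerm n y v (ζ + b))
    (g' := fun (b : ℤ) (v : ℝ) => 2 * π * I * (2 * n)
        * ee (2 * n * v * (ζ + b) + I * n / (2 * y) * (ζ + b) ^ 2))
    (u := fun b : ℤ => 2 * π * (2 * n) * Real.exp (4 * π * n * B * |ζ.im|)
      * ‖ee (I * n / (2 * y) * (ζ + b) ^ 2)‖)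
    ((summable_gaussian_shift hn hy ζ).norm.mul_left _) isOpen_Ioo isPreconnected_Ioo
    (fun b w _ => ?_) (fun b w hw => ?_) hv (summable_latticeTerm hn hy v ζ) hv
  · have hb : ζ + b ≠ 0 := fun h => hζ ((ee_eq_one_iff ζ).mpr ⟨-b, by
      push_cast; exact eq_neg_of_add_eq_zero_left h⟩)
    have h1 : HasDerivAt (fun w : ℝ => 2 * π * I * (2 * n * (w : ℂ) * (ζ + b)
        + I * n / (2 * y) * (ζ + b) ^ 2)) (2 * π * I * (2 * n * (ζ + b))) w := by
      have := (((((hasDerivAt_id w).ofReal_comp).const_mul (2 * n : ℂ)).mul_const (ζ + b)).add_const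
        (I * n / (2 * y) * (ζ + b) ^ 2)).const_mul (2 * π * I)
      simpa using this
    have h2 := h1.cexp.div_const (ζ + b)
    refine h2.congr_deriv ?_
    rw [ee]
    field_simp
  · rw [norm_mul (2 * π * I * (2 * n) : ℂ), ee_add, norm_mul (ee _), norm_ee_two_mul]
    have h1 : ‖(2 * π * I * (2 * n) : ℂ)‖ = 2 * π * (2 * n) := by
      simp [abs_of_pos Real.pi_pos]
    have h2 : -(4 * π * n * w * ζ.im) ≤ 4 * π * n * B * |ζ.im| := by
      have h3 : -(w * ζ.im) ≤ B * |ζ.im| := by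
        refine (neg_le_abs _).trans ?_
        rw [abs_mul]
        exact mul_le_mul_of_nonneg_right (abs_le.mpr ⟨hw.1.le, hw.2.le⟩) (abs_nonneg _)
      have := mul_le_mul_of_nonneg_left h3 (show 0 ≤ 4 * π * n by positivity)
      linarith
    rw [h1, mul_assoc _ (Real.exp (4 * π * n * B * |ζ.im|))]
    refine mul_le_mul_of_nonneg_left ?_ (by positivity)
    exact mul_le_mul_of_nonneg_right (Real.exp_le_exp.mpr h2) (norm_nonneg _)

/-- Poisson summation for the `v`-derivative of the kernel. -/
theorem tsum_gaussian_ee {n : ℕ} (hn : 0 < n) {y : ℝ} (hy : 0 < y) (ζ : ℂ) (v : ℝ) :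
    √(y / n) * ∑' N : ℤ, ((Real.exp (-(π * ((N + 2 * n * v) * √(y / n)) ^ 2)) : ℝ) : ℂ)
        * ee (-(N * ζ))
      = ∑' b : ℤ, ee (2 * n * v * (ζ + b) + I * n / (2 * y) * (ζ + b) ^ 2) := by
  have hn' : (0 : ℝ) < n := Nat.cast_pos.mpr hn
  have hyn : 0 < y / n := by positivity
  have hnC : (n : ℂ) ≠ 0 := Nat.cast_ne_zero.mpr hn.ne'
  have hyC : (y : ℂ) ≠ 0 := Complex.ofReal_ne_zero.mpr hy.ne'
  have h := Complex.tsum_exp_neg_quadratic (a := ((y / n : ℝ) : ℂ))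
    (by rw [Complex.ofReal_re]; exact hyn) (-(2 * v * y) - I * ζ)
  have hs : (((y / n : ℝ) : ℂ)) ^ (1 / 2 : ℂ) = (√(y / n) : ℝ) := by
    rw [Real.sqrt_eq_rpow, Complex.ofReal_cpow hyn.le]
    norm_num
  have hs0 : ((√(y / n) : ℝ) : ℂ) ≠ 0 := by
    rw [Complex.ofReal_ne_zero]; positivity
  rw [hs] at h
  have e1 : ∀ N : ℤ, ((Real.exp (-(π * ((N + 2 * n * v) * √(y / n)) ^ 2)) : ℝ) : ℂ)
        * ee (-(N * ζ)) = cexp (-(4 * π * n * v ^ 2 * y)) *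
        cexp (-π * ((y / n : ℝ) : ℂ) * N ^ 2 + 2 * π * (-(2 * v * y) - I * ζ) * N) := by
    intro N
    rw [sq_mul_sqrt_div hy, ee, Complex.ofReal_exp, ← Complex.exp_add, ← Complex.exp_add]
    congr 1
    push_cast
    field_simp
    ring
  have e2 : ∀ b : ℤ, ee (2 * n * v * (ζ + b) + I * n / (2 * y) * (ζ + b) ^ 2)
      = cexp (-(4 * π * n * v ^ 2 * y)) *
        cexp (-π / ((y / n : ℝ) : ℂ) * (b + I * (-(2 * v * y) - I * ζ)) ^ 2) := by
    intro b
    rw [ee, ← Complex.exp_add]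
    congr 1
    push_cast
    field_simp
    have hI := Complex.I_sq
    linear_combination (b ^ 2 + 4 * v ^ 2 * y ^ 2 + 4 * I * ζ * v * y + I ^ 2 * ζ ^ 2) * hI
  rw [tsum_congr e1, tsum_congr e2, tsum_mul_left, tsum_mul_left, h]
  field_simp

/-- The kernel as a sum of simple poles with Gaussian weights. -/
theorem kernel_eq_lattice_tsum {n : ℕ} (hn : 0 < n) {y : ℝ} (hy : 0 < y) (v : ℝ) {ζ : ℂ}
    (hζ : ee ζ ≠ 1) :
    kernel n y v ζ = -(1 / (2 * π * I)) * ∑' b : ℤ, latticeTerm n y v (ζ + b) := by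
  have hn' : (n : ℝ) ≠ 0 := Nat.cast_ne_zero.mpr hn.ne'
  -- `D` is the difference of the two sides. It has zero derivative in `v`, hence is constant, and
  -- it is multiplied by `ee ζ ≠ 1` under `v ↦ v + 1/(2n)`, hence is zero.
  set D : ℝ → ℂ := fun v => kernel n y v ζ
    + 1 / (2 * π * I) * ∑' b : ℤ, latticeTerm n y v (ζ + b) with hD
  have hder : ∀ v, HasDerivAt D 0 v := by
    intro v
    have h1 := ((hasDerivAt_error_tsum hn hy ζ v).const_mul (1 / 2 : ℂ)).const_add
      (1 / (1 - ee ζ))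
    have h2 := (hasDerivAt_lattice_tsum hn hy hζ v).const_mul (1 / (2 * π * I) : ℂ)
    refine (h1.add h2).congr_deriv ?_
    rw [tsum_mul_left, ← tsum_gaussian_ee hn hy ζ v]
    have e : ∀ N : ℤ, ((-(2 * Real.exp (-(π * ((N + 2 * n * v) * √(y / n)) ^ 2))
          * (2 * n * √(y / n))) : ℝ) : ℂ) * ee (-(N * ζ))
        = -(4 * n * √(y / n)) * (((Real.exp (-(π * ((N + 2 * n * v) * √(y / n)) ^ 2)) : ℝ) : ℂ)
          * ee (-(N * ζ))) := by
      intro N; push_cast; ring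
    rw [tsum_congr e, tsum_mul_left]
    generalize (∑' N : ℤ, _ : ℂ) = S
    have := Complex.two_pi_I_ne_zero
    field_simp
    ring
  have hconst : ∀ v w, D v = D w :=
    is_const_of_deriv_eq_zero (fun v => (hder v).differentiableAt) fun v => (hder v).deriv
  have hshift : D (v + 1 / (2 * n)) = ee ζ * D v := by
    simp only [hD]
    rw [kernel_shift_one hn hy v hζ, mul_add]
    congr 1
    rw [mul_left_comm, ← tsum_mul_left (a := ee ζ)]
    congr 1
    refine tsum_congr fun b => ?_
    rw [latticeTerm, latticeTerm, ← mul_div_assoc, ← ee_add]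
    congr 1
    have hnC : (n : ℂ) ≠ 0 := Nat.cast_ne_zero.mpr hn.ne'
    -- The shift produces `ee (ζ + b)`, which equals `ee ζ` for every pole because `b` is an
    -- integer.
    refine ee_congr b ?_
    push_cast
    field_simp
    ring
  rw [hconst _ v] at hshift
  have h0 : D v = 0 := by
    by_contra hne
    exact hζ (mul_right_cancel₀ hne (by rw [one_mul]; exact hshift.symm))
  have : kernel n y v ζ + 1 / (2 * π * I) * ∑' b : ℤ, latticeTerm n y v (ζ + b) = 0 := h0
  linear_combination this

/-! ### Splitting the kernel by residues modulo `M` -/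

theorem sum_range_periodic {M : ℕ} [NeZero M] {f : ℤ → ℂ} (hf : ∀ x, f (x + M) = f x)
    (a : ℤ) {c : ℤ} (hc : IsUnit (c : ZMod M)) :
    ∑ i ∈ Finset.range M, f (a + c * i) = ∑ i ∈ Finset.range M, f i := by
  have hper : Function.Periodic f (M : ℤ) := hf
  have hval : ∀ x : ℤ, f ((x : ZMod M).val : ℤ) = f x := by
    intro x
    rw [ZMod.val_intCast, Int.emod_def, mul_comm]
    exact hper.sub_int_mul_eq (x / M)
  have hsum : ∀ F : ZMod M → ℂ, ∑ u : ZMod M, F u = ∑ i ∈ Finset.range M, F (i : ℤ) := by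
    intro F
    symm
    refine Finset.sum_bij' (fun i _ => ((i : ℤ) : ZMod M)) (fun u _ => u.val) ?_ ?_ ?_ ?_ ?_
    · simp
    · intro u _; exact Finset.mem_range.mpr u.val_lt
    · intro i hi; simp [ZMod.val_natCast, Nat.mod_eq_of_lt (Finset.mem_range.mp hi)]
    · intro u _; simp
    · intro i _; rfl
  obtain ⟨c', hc'⟩ := hc
  have h1 := hsum fun u => f (((a : ZMod M) + c * u).val : ℤ)
  have h2 := hsum fun u => f (u.val : ℤ)
  have e1 : ∀ i : ℕ, f (((a : ZMod M) + c * ((i : ℤ) : ZMod M)).val : ℤ) = f (a + c * i) := by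
    intro i
    rw [← hval (a + c * i)]
    push_cast; rfl
  simp only [e1] at h1
  simp only [hval] at h2
  rw [← h1, ← h2]
  refine Fintype.sum_equiv ((Units.mulLeft c').trans (Equiv.addLeft (a : ZMod M))) _ _ fun u => ?_
  simp [hc']

theorem tsum_int_split {M : ℕ} [NeZero M] {f : ℤ → ℂ} (hf : Summable f) :
    ∑' N, f N = ∑ t ∈ Finset.range M, ∑' q : ℤ, f (M * q + t) := by
  have h1 := hf.comp_injective
    ((Equiv.prodComm (Fin M) ℤ).trans (Int.divModEquiv M).symm).injective
  rw [← ((Equiv.prodComm (Fin M) ℤ).trans (Int.divModEquiv M).symm).tsum_eq f, Finset.sum_range]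
  refine (h1.tsum_prod.trans (tsum_fintype _)).trans (Finset.sum_congr rfl fun t _ => tsum_congr fun q => ?_)
  simp [Int.divModEquiv, mul_comm]

theorem tsum_int_split_neg {M : ℕ} [NeZero M] {f : ℤ → ℂ} (hf : Summable f) :
    ∑' N, f N = ∑ t ∈ Finset.range M, ∑' q : ℤ, f (M * q - t) := by
  have h := tsum_int_split (M := M) ((Equiv.neg ℤ).summable_iff.mpr hf)
  rw [← (Equiv.neg ℤ).tsum_eq f]
  refine h.trans (Finset.sum_congr rfl fun t _ => ?_)
  rw [← (Equiv.neg ℤ).tsum_eq]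
  refine tsum_congr fun q => ?_
  simp only [Function.comp, Equiv.neg_apply]
  congr 1
  ring

/-- For `0 ≤ t < M`, `Mq - t ≥ 1` exactly when `q ≥ 1`. This is why `kernel` has its jump between 0
and 1: the sign then depends on `q` alone. -/
theorem sign_mul_sub {M : ℕ} {t : ℕ} (ht : t < M) (q : ℤ) :
    Real.sign (((M * q - t : ℤ) : ℝ) + -(1 / 2)) = Real.sign ((q : ℝ) + -(1 / 2)) := by
  have ht' : (t : ℝ) + 1 ≤ M := by exact_mod_cast ht
  push_cast
  rcases le_or_gt q 0 with h | h
  · have h' : (q : ℝ) ≤ 0 := by exact_mod_cast h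
    rw [Real.sign_of_neg (by nlinarith), Real.sign_of_neg (by linarith)]
  · have h' : (1 : ℝ) ≤ q := by exact_mod_cast h
    rw [Real.sign_of_pos (by nlinarith), Real.sign_of_pos (by linarith)]

/-- With `x = ee ζ`, use `1/(1 - x) = ∑_{t<M} x^t/(1 - x^M)` for the rational part and split the
error series by `N = Mq - t`. The two decompositions match residue by residue. -/
theorem kernel_split {n : ℕ} (hn : 0 < n) {y : ℝ} (hy : 0 < y) (v : ℝ) {M : ℕ} (hM : 0 < M)
    {ζ : ℂ} (hζ : ee (M * ζ) ≠ 1) :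
    kernel n (y / M) v ζ = ∑ t ∈ Finset.range M,
      ee (t * ζ) * kernel n (M * y) ((v - t / (2 * n)) / M) (M * ζ) := by
  have : NeZero M := ⟨hM.ne'⟩
  have hM' : (0 : ℝ) < M := Nat.cast_pos.mpr hM
  have hn' : (n : ℝ) ≠ 0 := Nat.cast_ne_zero.mpr hn.ne'
  have hyM : 0 < y / M := by positivity
  have hx : 1 - ee ζ ^ M ≠ 0 := by
    rw [← ee_nat_mul]; exact sub_ne_zero.mpr (Ne.symm hζ)
  have hx1 : 1 - ee ζ ≠ 0 := by
    intro h
    apply hx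
    rw [← sub_eq_zero.mp h]; simp
  have hgeom : 1 / (1 - ee ζ) = ∑ t ∈ Finset.range M, ee (t * ζ) * (1 / (1 - ee (M * ζ))) := by
    simp only [ee_nat_mul]
    rw [← Finset.sum_mul]
    have := mul_neg_geom_sum (ee ζ) M
    field_simp
    exact this.symm
  have hs := summable_kernel abs_neg_half hn hyM v ζ
  rw [kernel, tsum_int_split_neg (M := M) hs, hgeom, Finset.mul_sum, ← Finset.sum_add_distrib]
  refine Finset.sum_congr rfl fun t ht => ?_
  rw [kernel, mul_add, mul_left_comm (ee (t * ζ)), ← tsum_mul_left (a := ee (t * ζ))]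
  congr 2
  refine tsum_congr fun q => ?_
  rw [sign_mul_sub (Finset.mem_range.mp ht), mul_left_comm, ← ee_add]
  have e1 : (t * ζ + -(q * (M * ζ)) : ℂ) = -(((M * q - t : ℤ) : ℂ) * ζ) := by push_cast; ring
  have hsq : √(M * y / n) = M * √(y / M / n) := by
    have : M * y / n = M ^ 2 * (y / M / n) := by field_simp
    rw [this, Real.sqrt_mul (by positivity), Real.sqrt_sq hM'.le]
  have e2 : ((q : ℝ) + 2 * n * ((v - t / (2 * n)) / M)) * √(M * y / n)
      = (((M * q - t : ℤ) : ℝ) + 2 * n * v) * √(y / M / n) := by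
    rw [hsq]
    push_cast
    field_simp
    ring
  rw [e1, e2]

/-- The splitting of the kernel, with the residues modulo `M` multiplied by `n`. -/
theorem kernel_split_mul {n : ℕ} (hn : 0 < n) {y : ℝ} (hy : 0 < y) (v : ℝ) {M : ℕ} (hM : 0 < M)
    (hnM : Nat.Coprime n M) {ζ : ℂ} (hζ : ee (M * ζ) ≠ 1) :
    kernel n (y / M) v ζ = ∑ d ∈ Finset.range M,
      ee (n * d * ζ) * kernel n (M * y) ((v - d / 2) / M) (M * ζ) := by
  have : NeZero M := ⟨hM.ne'⟩
  have hM' : (0 : ℝ) < M := Nat.cast_pos.mpr hM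
  have hn' : (n : ℝ) ≠ 0 := Nat.cast_ne_zero.mpr hn.ne'
  set f : ℤ → ℂ := fun t => ee (t * ζ) * kernel n (M * y) ((v - t / (2 * n)) / M) (M * ζ) with hf
  -- Replacing `t` by `t + M` shifts the elliptic parameter by `-1/(2n)`. The resulting factor `ee
  -- (-Mζ)` cancels the change in `ee (tζ)`, so the residues may be permuted by `t = nd`.
  have hper : ∀ t, f (t + M) = f t := by
    intro t
    have h := kernel_shift hn (mul_pos hM' hy) ((v - t / (2 * n)) / M) hζ (-1)
    have e : (v - ((t + M : ℤ) : ℝ) / (2 * n)) / M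
        = (v - t / (2 * n)) / M + ((-1 : ℤ) : ℝ) / (2 * n) := by
      push_cast; field_simp; ring
    simp only [hf]
    rw [e, h, ← mul_assoc, ← ee_add]
    congr 2
    push_cast; ring
  have h := sum_range_periodic hper 0 (c := n)
    (by rw [Int.cast_natCast]; exact (ZMod.isUnit_iff_coprime n M).mpr hnM)
  rw [kernel_split hn hy v hM hζ]
  refine Eq.trans ?_ (h.symm.trans ?_)
  · simp [hf]
  · refine Finset.sum_congr rfl fun d _ => ?_
    simp only [hf]
    congr 2
    · push_cast; ring
    · push_cast; field_simp; ring

/-! ### The completed Appell function -/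

/-- The completed Appell function of index `n`, in the variables `w = (z₁ - z₂) / 2` and
`s = z₁ + z₂`. -/
def appell (n : ℕ) (τ w s : ℂ) : ℂ :=
  ∑' l : ℤ, ee (n * l * s + n * l ^ 2 * τ) * kernel n τ.im (w.im / τ.im) (w + s / 2 + l * τ)

/-- The terms of the expansion of `appell` over the lattice `ℤτ + ℤ`. -/
def appellTerm (n : ℕ) (τ w s : ℂ) (p : ℤ × ℤ) : ℂ :=
  ee (n * p.1 * s + n * p.1 ^ 2 * τ)
    * latticeTerm n τ.im (w.im / τ.im) (w + s / 2 + p.1 * τ + p.2)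

theorem finite_norm_lattice_lt {τ : ℂ} (hτ : 0 < τ.im) (ζ : ℂ) :
    {p : ℤ × ℤ | ‖ζ + p.1 * τ + p.2‖ < 1}.Finite := by
  set L : ℤ := ⌈(|ζ.im| + 1) / τ.im⌉ with hL
  refine ((Set.finite_Icc (-L) L).biUnion fun l _ =>
    (finite_norm_add_int_lt (ζ + l * τ)).image fun b => (l, b)).subset ?_
  rintro ⟨l, b⟩ hp
  simp only [Set.mem_ofPred_eq] at hp
  simp only [Set.mem_iUnion, Set.mem_image, Set.mem_ofPred_eq]
  refine ⟨l, ?_, b, hp, rfl⟩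
  have h1 : |ζ.im + l * τ.im| < 1 := by
    refine lt_of_le_of_lt ?_ hp
    simpa using Complex.abs_im_le_norm (ζ + l * τ + b)
  have h2 := abs_lt.mp h1
  have h3 := abs_le.mp (le_refl |ζ.im|)
  have h4 := (div_le_iff₀ hτ).mp (Int.le_ceil ((|ζ.im| + 1) / τ.im))
  rw [← hL] at h4
  constructor
  · have : ((-L : ℤ) : ℝ) ≤ l := by
      push_cast
      refine le_of_mul_le_mul_right ?_ hτ
      linarith
    exact_mod_cast this
  · have : (l : ℝ) ≤ L := by
      refine le_of_mul_le_mul_right ?_ hτ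
      linarith
    exact_mod_cast this

theorem summable_appellTerm {n : ℕ} (hn : 0 < n) {τ : ℂ} (hτ : 0 < τ.im) (w s : ℂ) :
    Summable (appellTerm n τ w s) := by
  have hn' : (0 : ℝ) < n := Nat.cast_pos.mpr hn
  obtain ⟨x, y⟩ := τ
  simp only at hτ
  set v : ℝ := w.im / y with hv
  set ζ : ℂ := w + s / 2 with hζ
  -- The form `|lτ + b|²` has determinant `y²` and trace `x² + y² + 1`. Determinant over trace is a
  -- lower bound for its smaller eigenvalue, so `c` bounds it below by `c(l² + b²)`.
  set c : ℝ := y ^ 2 / (x ^ 2 + y ^ 2 + 1) with hc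
  have hcpos : 0 < c := by positivity
  have ha : 0 < 2 * π * (n / (2 * y) * c) := by positivity
  have hsum := (summable_exp_quadratic ha
      (-(2 * π * (n * s.im + 2 * n * v * y + n / y * (ζ.re * x - ζ.im * y))))
      (-(2 * π * (2 * n * v * ζ.im + n / (2 * y) * (ζ.re ^ 2 - ζ.im ^ 2))))).mul_of_nonneg
    (summable_exp_quadratic ha (-(2 * π * (n / y * ζ.re))) 0)
    (fun _ => (Real.exp_pos _).le) fun _ => (Real.exp_pos _).le
  refine Summable.of_norm_bounded_eventually hsum ?_
  filter_upwards [(finite_norm_lattice_lt (τ := ⟨x, y⟩) hτ ζ).compl_mem_cofinite] with p hp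
  obtain ⟨l, b⟩ := p
  have hp' : 1 ≤ ‖ζ + l * (⟨x, y⟩ : ℂ) + b‖ := not_lt.mp hp
  rw [appellTerm, latticeTerm, norm_mul, norm_div, ← mul_div_assoc, ← norm_mul, ← ee_add]
  refine (div_le_self (norm_nonneg _) hp').trans ?_
  rw [norm_ee, ← Real.exp_add, Real.exp_le_exp]
  have him : (n * l * s + n * l ^ 2 * (⟨x, y⟩ : ℂ) + (2 * n * v * (ζ + l * (⟨x, y⟩ : ℂ) + b)
      + I * n / (2 * y) * (ζ + l * (⟨x, y⟩ : ℂ) + b) ^ 2)).im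
      = n * l * s.im + n * l ^ 2 * y + 2 * n * v * (ζ.im + l * y)
        + n / (2 * y) * ((ζ.re + l * x + b) ^ 2 - (ζ.im + l * y) ^ 2) := by
    have e0 : (⟨x, y⟩ : ℂ) = x + y * I := by apply Complex.ext <;> simp
    have e1 : ζ = (ζ.re : ℂ) + (ζ.im : ℂ) * I := (Complex.re_add_im ζ).symm
    have e2 : s = (s.re : ℂ) + (s.im : ℂ) * I := (Complex.re_add_im s).symm
    have hyC : (y : ℂ) ≠ 0 := Complex.ofReal_ne_zero.mpr hτ.ne'
    have : (n * l * s + n * l ^ 2 * (⟨x, y⟩ : ℂ) + (2 * n * v * (ζ + l * (⟨x, y⟩ : ℂ) + b)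
      + I * n / (2 * y) * (ζ + l * (⟨x, y⟩ : ℂ) + b) ^ 2))
      = ((n * l * s.re + n * l ^ 2 * x + 2 * n * v * (ζ.re + l * x + b)
          - n / y * ((ζ.re + l * x + b) * (ζ.im + l * y)) : ℝ) : ℂ)
        + ((n * l * s.im + n * l ^ 2 * y + 2 * n * v * (ζ.im + l * y)
        + n / (2 * y) * ((ζ.re + l * x + b) ^ 2 - (ζ.im + l * y) ^ 2) : ℝ) : ℂ) * I := by
      rw [e0]
      conv_lhs => rw [e1, e2]
      push_cast
      field_simp
      have hI := Complex.I_sq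
      have hI3 : I ^ 3 = -I := by rw [pow_succ, hI]; ring
      ring_nf
      simp only [hI3, hI]
      ring
    rw [this, Complex.add_im, Complex.ofReal_im, Complex.im_ofReal_mul, Complex.I_im]
    ring
  rw [him]
  -- The growing part `-l²y²` of the pole's Gaussian is outweighed by the `2l²y²` coming from `n l²
  -- τ`. What remains is the positive definite form `|lτ + b|²`.
  have hq : c * ((l : ℝ) ^ 2 + (b : ℝ) ^ 2) ≤ l ^ 2 * y ^ 2 + (l * x + b) ^ 2 := by
    rw [hc, div_mul_eq_mul_div, div_le_iff₀ (by positivity)]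
    nlinarith [sq_nonneg ((x ^ 2 + y ^ 2) * l + x * b), sq_nonneg (x * l + b)]
  have hq' := mul_le_mul_of_nonneg_left hq (show 0 ≤ 2 * π * (n / (2 * y)) by positivity)
  have hyy : y * y⁻¹ = 1 := mul_inv_cancel₀ hτ.ne'
  have key : -(2 * π * (n / (2 * y) * c) * (l : ℝ) ^ 2) +
      -(2 * π * (n * s.im + 2 * n * v * y + n / y * (ζ.re * x - ζ.im * y))) * l +
      -(2 * π * (2 * n * v * ζ.im + n / (2 * y) * (ζ.re ^ 2 - ζ.im ^ 2))) +
      (-(2 * π * (n / (2 * y) * c) * (b : ℝ) ^ 2) + -(2 * π * (n / y * ζ.re)) * b + 0)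
      - -(2 * π * (n * l * s.im + n * l ^ 2 * y + 2 * n * v * (ζ.im + l * y)
        + n / (2 * y) * ((ζ.re + l * x + b) ^ 2 - (ζ.im + l * y) ^ 2)))
      = 2 * π * (n / (2 * y)) * (l ^ 2 * y ^ 2 + (l * x + b) ^ 2)
        - 2 * π * (n / (2 * y)) * (c * ((l : ℝ) ^ 2 + (b : ℝ) ^ 2)) := by
    clear_value c v ζ
    field_simp
    ring
  linarith

theorem appell_eq_tsum {n : ℕ} (hn : 0 < n) {τ : ℂ} (hτ : 0 < τ.im) {w s : ℂ}
    (hreg : ∀ a b : ℤ, w + s / 2 ≠ a + b * τ) :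
    appell n τ w s = -(1 / (2 * π * I)) * ∑' p, appellTerm n τ w s p := by
  rw [(summable_appellTerm hn hτ w s).tsum_prod, appell, ← tsum_mul_left]
  refine tsum_congr fun l => ?_
  have h : ee (w + s / 2 + l * τ) ≠ 1 := fun h => by
    obtain ⟨k, hk⟩ := (ee_eq_one_iff _).mp h
    exact hreg k (-l) (by push_cast; linear_combination hk)
  rw [kernel_eq_lattice_tsum hn hτ _ h, mul_left_comm, ← tsum_mul_left (a := ee _)]
  rfl

theorem summable_appell {n : ℕ} (hn : 0 < n) {τ : ℂ} (hτ : 0 < τ.im) {w s : ℂ}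
    (hreg : ∀ a b : ℤ, w + s / 2 ≠ a + b * τ) :
    Summable fun l : ℤ => ee (n * l * s + n * l ^ 2 * τ)
      * kernel n τ.im (w.im / τ.im) (w + s / 2 + l * τ) := by
  refine ((summable_appellTerm hn hτ w s).prod.mul_left (-(1 / (2 * π * I)))).congr fun l => ?_
  have h : ee (w + s / 2 + l * τ) ≠ 1 := fun h => by
    obtain ⟨k, hk⟩ := (ee_eq_one_iff _).mp h
    exact hreg k (-l) (by push_cast; linear_combination hk)
  rw [kernel_eq_lattice_tsum hn hτ _ h, mul_left_comm (ee _), ← tsum_mul_left (a := ee _)]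
  rfl

theorem im_neg_one_div_pos {τ : ℂ} (hτ : 0 < τ.im) : 0 < (-1 / τ).im := by
  have := UpperHalfPlane.im_inv_neg_coe_pos ⟨τ, hτ⟩
  rw [neg_div, one_div, ← inv_neg]
  exact this

theorem ofReal_im_neg_one_div {τ : ℂ} (hτ : 0 < τ.im) :
    (((-1 / τ).im : ℝ) : ℂ) = τ.im / (τ * (τ - 2 * I * τ.im)) := by
  have h0 : τ ≠ 0 := fun h => by simp [h] at hτ
  have e : τ - 2 * I * τ.im = (starRingEnd ℂ) τ := by
    apply Complex.ext <;> simp; ring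
  rw [e, Complex.mul_conj]
  simp [neg_div]

/-- In real coordinates `w = vτ + u`, inversion sends `(v, u)` to `(-u, v)`, and here `-u = vτ - w`.
The complex form allows direct substitution into exponents. -/
theorem ofReal_im_div_div {τ : ℂ} (hτ : 0 < τ.im) (w : ℂ) :
    (((w / τ).im / (-1 / τ).im : ℝ) : ℂ) = ((w.im / τ.im : ℝ) : ℂ) * τ - w := by
  have h0 : τ ≠ 0 := fun h => by simp [h] at hτ
  have hN : Complex.normSq τ ≠ 0 := fun h => h0 (Complex.normSq_eq_zero.mp h)
  have h1 : (w / τ).im / (-1 / τ).im = w.im / τ.im * τ.re - w.re := by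
    simp [Complex.div_im]
    field_simp
  rw [h1]
  apply Complex.ext
  · simp
  · simp
    field_simp
    simp

/-- The pole at `-1/τ` is the rotated pole divided by `τ`, which yields the factor `τ`. Since `conj
τ = τ - 2iy`, the transformed Gaussian is the old one plus `nZ²/τ`, and the rest of the exponent
matches up to an integer. -/
theorem appellTerm_S {n : ℕ} {τ : ℂ} (hτ : 0 < τ.im) (w s : ℂ) (p : ℤ × ℤ) :
    appellTerm n (-1 / τ) (w / τ) (s / τ) p
      = τ * ee (n * (s ^ 2 / 4 - w ^ 2) / τ) * appellTerm n τ w s (p.2, -p.1) := by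
  obtain ⟨l, b⟩ := p
  have h0 : τ ≠ 0 := fun h => by simp [h] at hτ
  have hy : (τ.im : ℂ) ≠ 0 := Complex.ofReal_ne_zero.mpr hτ.ne'
  have hZ : w / τ + s / τ / 2 + l * (-1 / τ) + b = (w + s / 2 + b * τ + (-l : ℤ)) / τ := by
    push_cast; field_simp; ring
  simp only [appellTerm, latticeTerm]
  rw [hZ, ofReal_im_div_div hτ, ofReal_im_neg_one_div hτ]
  set Z := w + s / 2 + b * τ + (-l : ℤ) with hZd
  set v : ℂ := ((w.im / τ.im : ℝ) : ℂ)
  set y : ℂ := (τ.im : ℂ)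
  have hR : ∀ A B C : ℂ, τ * ee A * (ee B * (ee C / Z)) = ee (A + (B + C)) / (Z / τ) := by
    intro A B C
    rw [ee_add, ee_add, div_div_eq_mul_div]
    ring
  rw [← mul_div_assoc, ← ee_add, hR]
  congr 1
  refine ee_congr (-(2 * n * l * b)) ?_
  have e : ∀ Z : ℂ, I * n / (2 * (y / (τ * (τ - 2 * I * y)))) * (Z / τ) ^ 2
      = I * n / (2 * y) * Z ^ 2 + n * Z ^ 2 / τ := by
    intro Z
    have hI := Complex.I_sq
    field_simp
    linear_combination (-2 * n * y * Z ^ 2) * hI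
  rw [e, hZd]
  push_cast
  field_simp
  ring

/-- The modular inversion of the completed Appell function. -/
theorem appell_S {n : ℕ} (hn : 0 < n) {τ : ℂ} (hτ : 0 < τ.im) {w s : ℂ}
    (hreg : ∀ a b : ℤ, w + s / 2 ≠ a + b * τ) :
    appell n (-1 / τ) (w / τ) (s / τ)
      = τ * ee (n * (s ^ 2 / 4 - w ^ 2) / τ) * appell n τ w s := by
  have h0 : τ ≠ 0 := fun h => by simp [h] at hτ
  have hreg' : ∀ a b : ℤ, w / τ + s / τ / 2 ≠ a + b * (-1 / τ) := by
    intro a b h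
    refine hreg (-b) a ?_
    field_simp at h
    push_cast
    linear_combination h / 2
  rw [appell_eq_tsum hn hτ hreg, appell_eq_tsum hn (im_neg_one_div_pos hτ) hreg',
    tsum_congr (appellTerm_S hτ w s), tsum_mul_left, mul_left_comm]
  congr 2
  exact ((Equiv.prodComm ℤ ℤ).trans (Equiv.prodCongr (Equiv.refl ℤ) (Equiv.neg ℤ))).tsum_eq
    (appellTerm n τ w s)

theorem im_half_int_mul (p : ℤ) (τ : ℂ) : (p * τ / 2 : ℂ).im = p / 2 * τ.im := by
  have : (p * τ / 2 : ℂ) = ((p / 2 : ℝ) : ℂ) * τ := by push_cast; ring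
  rw [this, Complex.im_ofReal_mul]

/-- Elliptic transformation of the completed Appell function under translations in `ℤτ`. -/
theorem appell_add_mul {n : ℕ} (hn : 0 < n) {τ : ℂ} (hτ : 0 < τ.im) {w s : ℂ}
    (hreg : ∀ a b : ℤ, w + s / 2 ≠ a + b * τ) (g r : ℤ) :
    appell n τ (w + (2 * g - r : ℤ) * τ / 2) (s + r * τ)
      = ee (n * ((2 * g - r) * w - r * s / 2) + n * τ * (g * (g - r))) * appell n τ w s := by
  have hn' : (n : ℝ) ≠ 0 := Nat.cast_ne_zero.mpr hn.ne'
  rw [appell, appell, ← tsum_mul_left, ← (Equiv.subRight g).tsum_eq]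
  refine tsum_congr fun l => ?_
  have hl : (((Equiv.subRight g) l : ℤ) : ℂ) = l - g := by simp
  have h : ee (w + s / 2 + l * τ) ≠ 1 := fun h => by
    obtain ⟨k, hk⟩ := (ee_eq_one_iff _).mp h
    exact hreg k (-l) (by push_cast; linear_combination hk)
  -- Translating `w` by `(2g - r)τ/2` moves `v` by `(2g - r)/2`, that is, by `n(2g - r)` steps of
  -- size `1/(2n)`. Reindexing `l` by `g` keeps the pole fixed.
  have hk := kernel_shift hn hτ (w.im / τ.im) h (n * (2 * g - r))
  have e1 : (w + (2 * g - r : ℤ) * τ / 2).im / τ.im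
      = w.im / τ.im + ((n * (2 * g - r) : ℤ) : ℝ) / (2 * n) := by
    rw [Complex.add_im, im_half_int_mul]
    push_cast
    field_simp
  have e2 : w + (2 * g - r : ℤ) * τ / 2 + (s + r * τ) / 2 + (l - g) * τ = w + s / 2 + l * τ := by
    push_cast; ring
  rw [hl, e1, e2, hk, ← mul_assoc, ← mul_assoc, ← ee_add, ← ee_add]
  congr 2
  push_cast
  ring

/-- Elliptic transformation of the completed Appell function under translations in `ℤ`. -/
theorem appell_add_int (n : ℕ) {τ : ℂ} (w s : ℂ) (g r : ℤ) :
    appell n τ (w + (2 * g - r : ℤ) / 2) (s + r) = appell n τ w s := by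
  rw [appell, appell]
  refine tsum_congr fun l => ?_
  have e1 : (w + (2 * g - r : ℤ) / 2 : ℂ).im = w.im := by
    have : ((2 * g - r : ℤ) / 2 : ℂ) = (((2 * g - r : ℤ) / 2 : ℝ) : ℂ) := by push_cast; ring
    rw [this, Complex.add_im, Complex.ofReal_im, add_zero]
  have e2 : w + (2 * g - r : ℤ) / 2 + (s + r) / 2 + l * τ = w + s / 2 + l * τ + g := by
    push_cast; ring
  rw [e1, e2, kernel_add_int]
  congr 1
  exact ee_congr (n * l * r) (by push_cast; ring)

/-- The completed Appell function at `τ / M` in terms of those at `Mτ`. -/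
theorem appell_div {n : ℕ} (hn : 0 < n) {τ : ℂ} (hτ : 0 < τ.im) {M : ℕ} (hM : 0 < M)
    (hnM : Nat.Coprime n M) {w s : ℂ} (hreg : ∀ a b : ℤ, w + s / 2 ≠ a + b * τ) :
    appell n (τ / M) (w / M) (s / M)
      = ∑ a ∈ Finset.range M, ∑ d ∈ Finset.range M,
        ee (n / M * (d * w + (2 * a + d) * s / 2) + n * (a * (a + d)) / M * τ)
          * appell n (M * τ) (w - d * τ / 2) (s + (2 * a + d) * τ) := by
  have : NeZero M := ⟨hM.ne'⟩
  have hM' : (0 : ℝ) < M := Nat.cast_pos.mpr hM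
  have hMC : (M : ℂ) ≠ 0 := Nat.cast_ne_zero.mpr hM.ne'
  have him : (τ / M).im = τ.im / M := by
    rw [← Complex.ofReal_natCast, Complex.div_ofReal_im]
  have himw : (w / M).im = w.im / M := by
    rw [← Complex.ofReal_natCast, Complex.div_ofReal_im]
  have himM : (M * τ).im = M * τ.im := by
    rw [← Complex.ofReal_natCast, Complex.im_ofReal_mul]
  have hτM : 0 < (τ / M).im := by rw [him]; positivity
  have hτM' : 0 < (M * τ).im := by rw [himM]; positivity
  have hv : (w / M).im / (τ / M).im = w.im / τ.im := by rw [him, himw]; field_simp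
  have hregM : ∀ a b : ℤ, w / M + s / M / 2 ≠ a + b * (τ / M) := by
    intro a b h
    refine hreg (a * M) b ?_
    field_simp at h
    push_cast
    linear_combination h / 2
  -- The residue `a` of the summation index mod `M` is separated here. The second residue `d` comes
  -- from `kernel_split_mul`, whose shift of `v` by `d/2` becomes `w - dτ/2`.
  rw [appell, tsum_int_split (M := M) (summable_appell hn hτM hregM)]
  refine Finset.sum_congr rfl fun a _ => ?_
  have hnp : ∀ l : ℤ, ee (M * (w / M + s / M / 2 + (M * l + a : ℤ) * (τ / M))) ≠ 1 := by
    intro l h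
    obtain ⟨k, hk⟩ := (ee_eq_one_iff _).mp h
    refine hreg k (-(M * l + a)) ?_
    field_simp at hk
    push_cast at hk ⊢
    linear_combination hk / 2
  have hregd : ∀ d : ℕ, ∀ x y : ℤ,
      w - d * τ / 2 + (s + (2 * a + d) * τ) / 2 ≠ x + y * (M * τ) := by
    intro d x y h
    refine hreg x (y * M - a) ?_
    push_cast
    linear_combination h
  have hsum : ∀ d ∈ Finset.range M, Summable fun l : ℤ =>
      ee (n / M * (d * w + (2 * a + d) * s / 2) + n * (a * (a + d)) / M * τ)
      * (ee (n * l * (s + (2 * a + d) * τ) + n * l ^ 2 * (M * τ))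
      * kernel n (M * τ).im ((w - d * τ / 2).im / (M * τ).im)
        (w - d * τ / 2 + (s + (2 * a + d) * τ) / 2 + l * (M * τ))) :=
    fun d _ => (summable_appell hn hτM' (hregd d)).mul_left _
  have hswap := Summable.tsum_finsetSum hsum
  simp only [tsum_mul_left] at hswap
  refine Eq.trans ?_ hswap
  refine tsum_congr fun l => ?_
  rw [hv, him, kernel_split_mul hn hτ _ hM hnM (hnp l), Finset.mul_sum]
  refine Finset.sum_congr rfl fun d _ => ?_
  have e1 : (w - d * τ / 2).im / (M * τ).im = (w.im / τ.im - d / 2) / M := by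
    have : (d * τ / 2 : ℂ).im = d / 2 * τ.im := by
      have := im_half_int_mul d τ
      push_cast at this
      exact this
    rw [Complex.sub_im, this, himM]
    field_simp
  have e2 : M * (w / M + s / M / 2 + (M * l + a : ℤ) * (τ / M))
      = w - d * τ / 2 + (s + (2 * a + d) * τ) / 2 + l * (M * τ) := by
    push_cast; field_simp; ring
  rw [e1, e2, himM, ← mul_assoc (ee _), ← mul_assoc (ee _), ← ee_add, ← ee_add]
  congr 2
  push_cast
  field_simp
  ring

/-! ### Zwegers' correction as a double series -/

theorem zwegersTerm_eq (n : ℕ) (τ v : ℂ) (N : ℤ) :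
    zwegersTerm n τ v N = ((Real.sign (N + 1 / 2)
      - E ((N + 2 * n * (v.im / τ.im)) * √(τ.im / n)) : ℝ) : ℂ)
      * ee (-τ / (4 * n) * N ^ 2 + -v * N) := by
  rw [zwegersTerm, ee]
  congr 2
  ring

theorem summable_zwegersTerm {n : ℕ} (hn : 0 < n) {τ : ℂ} (hτ : 0 < τ.im) (v : ℂ) :
    Summable (zwegersTerm n τ v) := by
  have hn' : (0 : ℝ) < n := Nat.cast_pos.mpr hn
  have hα : 0 < τ.im / n + 2 * (-τ / (4 * n) : ℂ).im := by
    have : (-τ / (4 * n) : ℂ) = ((-(1 / (4 * n)) : ℝ) : ℂ) * τ := by push_cast; ring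
    rw [this, Complex.im_ofReal_mul]
    have : τ.im / n + 2 * (-(1 / (4 * n)) * τ.im) = τ.im / (2 * n) := by field_simp; ring
    rw [this]; positivity
  exact (summable_sign_sub_E_mul_ee abs_half n hτ (v.im / τ.im) hα (-v)).congr
    fun N => (zwegersTerm_eq n τ v N).symm

theorem Theta_eq {n : ℕ} (hn : 0 < n) (j : ℤ) (τ z : ℂ) :
    Theta j n τ z = ∑' k : ℤ, ee (τ / (4 * n) * (2 * n * k + j) ^ 2 + (2 * n * k + j) * z / 2) := by
  have hnC : (n : ℂ) ≠ 0 := Nat.cast_ne_zero.mpr hn.ne'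
  rw [Theta]
  refine tsum_congr fun k => ?_
  rw [qpow_eq_ee, ← ee_add]
  congr 1
  field_simp
  ring

theorem Theta_add_mul {n : ℕ} (hn : 0 < n) (j l : ℤ) (τ z : ℂ) :
    Theta (j + 2 * n * l) n τ z = Theta j n τ z := by
  rw [Theta_eq hn, Theta_eq hn, ← (Equiv.addRight l).tsum_eq (fun k : ℤ =>
    ee (τ / (4 * n) * (2 * n * k + j) ^ 2 + (2 * n * k + j) * z / 2))]
  refine tsum_congr fun k => ?_
  simp only [Equiv.coe_addRight]
  congr 1
  push_cast
  ring

theorem Theta_neg (j : ℤ) (n : ℕ) (τ z : ℂ) : Theta (-j) n τ (-z) = Theta j n τ z := by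
  rw [Theta, Theta, ← (Equiv.neg ℤ).tsum_eq]
  refine tsum_congr fun k => ?_
  simp only [qpow_eq_ee, Equiv.neg_apply]
  push_cast
  congr 1 <;> (congr 1; ring)

theorem summable_theta_ee {n : ℕ} (hn : 0 < n) {τ : ℂ} (hτ : 0 < τ.im) (z : ℂ) :
    Summable fun L : ℤ => ee (τ / (4 * n) * L ^ 2 + L * z / 2) := by
  have hn' : (0 : ℝ) < n := Nat.cast_pos.mpr hn
  have hα : 0 < (τ / (4 * n) : ℂ).im := by
    have : (τ / (4 * n) : ℂ) = (((1 / (4 * n)) : ℝ) : ℂ) * τ := by push_cast; ring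
    rw [this, Complex.im_ofReal_mul]
    positivity
  refine (summable_ee_quadratic hα (z / 2) 0).congr fun L => ?_
  congr 1; ring

/-- The terms of the correction, as a double series. -/
def correctionTerm (n : ℕ) (τ w s : ℂ) (k N : ℤ) : ℂ :=
  zwegersTerm n τ w N * ee (τ / (4 * n) * (2 * n * k - N) ^ 2 + (2 * n * k - N) * s / 2)

/-- The map `(k, N) ↦ (N, 2nk - N)` is injective, so this is a subfamily of the product of two
absolutely convergent series. -/
theorem summable_correctionTerm {n : ℕ} (hn : 0 < n) {τ : ℂ} (hτ : 0 < τ.im) (w s : ℂ) :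
    Summable fun p : ℤ × ℤ => correctionTerm n τ w s p.1 p.2 := by
  have h := summable_mul_of_summable_norm (summable_zwegersTerm hn hτ w).norm
    (summable_theta_ee hn hτ s).norm
  have hinj : Function.Injective fun p : ℤ × ℤ => (p.2, 2 * n * p.1 - p.2) := by
    rintro ⟨a, b⟩ ⟨c, d⟩ h
    simp only [Prod.mk.injEq] at h
    obtain ⟨h1, h2⟩ := h
    subst h1
    have hn' : (2 * n : ℤ) ≠ 0 := by positivity
    have : a = c := mul_left_cancel₀ hn' (by linarith)
    rw [this]
  refine (h.comp_injective hinj).congr fun p => ?_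
  simp only [Function.comp, correctionTerm]
  push_cast
  rfl

/-- The exponents `-τN²/(4n)` and `τ(2nk - N)²/(4n)` add up to `nk²τ - kNτ`. The square of `N`
cancels, leaving the error series of `kernel` at `ζ = w + s/2 + kτ`. -/
theorem correctionTerm_eq {n : ℕ} (hn : 0 < n) (τ w s : ℂ) (k N : ℤ) :
    correctionTerm n τ w s k N = ee (n * k * s + n * k ^ 2 * τ)
      * (((Real.sign (N + 1 / 2) - E ((N + 2 * n * (w.im / τ.im)) * √(τ.im / n)) : ℝ) : ℂ)
        * ee (-(N * (w + s / 2 + k * τ)))) := by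
  have hnC : (n : ℂ) ≠ 0 := Nat.cast_ne_zero.mpr hn.ne'
  rw [correctionTerm, zwegersTerm_eq, mul_left_comm, mul_assoc, ← ee_add, ← ee_add]
  congr 2
  field_simp
  ring

/-- Sum over `k` first: this gives `Θ_{-N}`, which depends on `N` only mod `2n`. Grouping `N` by
residues then collects the weights into `zwegersR`. -/
theorem tsum_correctionTerm {n : ℕ} (hn : 0 < n) {τ : ℂ} (hτ : 0 < τ.im) (w s : ℂ) :
    ∑' k : ℤ, ∑' N : ℤ, correctionTerm n τ w s k N
      = ∑ j ∈ Finset.range (2 * n), zwegersR n j τ w * Theta (-j) n τ s := by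
  have : NeZero (2 * n) := ⟨by positivity⟩
  have hs := summable_correctionTerm hn hτ w s
  have hTh : ∀ N : ℤ, ∑' k : ℤ, correctionTerm n τ w s k N
      = zwegersTerm n τ w N * Theta (-N) n τ s := by
    intro N
    simp only [correctionTerm]
    rw [tsum_mul_left, Theta_eq hn]
    congr 1
    refine tsum_congr fun k => ?_
    push_cast
    congr 1
  have hs2 : Summable fun N : ℤ => zwegersTerm n τ w N * Theta (-N) n τ s := by
    have := (hs.comp_injective (Equiv.prodComm ℤ ℤ).injective).prod
    exact this.congr fun N => hTh N
  rw [← Summable.tsum_comm (f := correctionTerm n τ w s) hs, tsum_congr hTh,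
    tsum_int_split (M := 2 * n) hs2]
  refine Finset.sum_congr rfl fun j _ => ?_
  rw [zwegersR, ← tsum_mul_right]
  refine tsum_congr fun l => ?_
  have e := Theta_add_mul hn (-j) (-l) τ s
  have e1 : ((2 * n : ℕ) : ℤ) * l + j = j + 2 * n * l := by push_cast; ring
  have e2 : -((j : ℤ) + 2 * n * l) = -j + 2 * n * -l := by ring
  rw [e1, e2, e]

theorem summable_tsum_correctionTerm {n : ℕ} (hn : 0 < n) {τ : ℂ} (hτ : 0 < τ.im) (w s : ℂ) :
    Summable fun k : ℤ => ∑' N : ℤ, correctionTerm n τ w s k N :=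
  (summable_correctionTerm hn hτ w s).prod

/-- The holomorphic part and the correction of the completed Appell function. -/
theorem hasSum_appell {n : ℕ} (hn : 0 < n) {τ : ℂ} (hτ : 0 < τ.im) {w s : ℂ}
    (hreg : ∀ a b : ℤ, w + s / 2 ≠ a + b * τ) :
    HasSum (fun l : ℤ => ee (n * l * s + n * l ^ 2 * τ) / (1 - ee (w + s / 2 + l * τ))
        - ee (n * l * s + n * l ^ 2 * τ))
      (appell n τ w s - 1 / 2 * ∑ j ∈ Finset.range (2 * n), zwegersR n j τ w * Theta (-j) n τ s) := by
  rw [← tsum_correctionTerm hn hτ]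
  have h := (summable_appell hn hτ hreg).hasSum.sub
    ((summable_tsum_correctionTerm hn hτ w s).hasSum.mul_left (1 / 2))
  convert! h using 1
  funext l
  have hx : ee (w + s / 2 + l * τ) ≠ 1 := fun h => by
    obtain ⟨k, hk⟩ := (ee_eq_one_iff _).mp h
    exact hreg k (-l) (by push_cast; linear_combination hk)
  rw [kernel_eq hn hτ _ hx, tsum_congr (correctionTerm_eq hn τ w s l), tsum_mul_left]
  have hx' : 1 - ee (w + s / 2 + l * τ) ≠ 0 := sub_ne_zero.mpr (Ne.symm hx)
  generalize (∑' N : ℤ, _ : ℂ) = S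
  generalize ee (w + s / 2 + l * τ) = x at hx'
  field_simp
  ring

theorem summable_appell_coeff {n : ℕ} (hn : 0 < n) {τ : ℂ} (hτ : 0 < τ.im) (s : ℂ) :
    Summable fun l : ℤ => ee (n * l * s + n * l ^ 2 * τ) := by
  have hn' : (0 : ℝ) < n := Nat.cast_pos.mpr hn
  have hα : 0 < (n * τ : ℂ).im := by
    rw [← Complex.ofReal_natCast, Complex.im_ofReal_mul]; positivity
  refine (summable_ee_quadratic hα (n * s) 0).congr fun l => ?_
  congr 1; ring

/-! ### Transformations of the modified function `PhiTilde` -/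

/-- `(τ, z)` avoids the lattice `ℤ + ℤτ`. -/
def OffLattice (τ z : ℂ) : Prop := ∀ a b : ℤ, z ≠ a + b * τ

theorem OffLattice.neg {τ z : ℂ} (h : OffLattice τ z) : OffLattice τ (-z) := by
  intro a b hz
  refine h (-a) (-b) ?_
  push_cast
  linear_combination -hz

/-- The two fractions in `Phi` are the holomorphic parts for `s` and `-s`. Because `Θ_{-j}(-s) =
Θ_j(s)`, the two corrections combine into `Θ_j - Θ_{-j}`. -/
theorem PhiTilde_eq (m : ℕ) {τ : ℂ} (hτ : 0 < τ.im) {z₁ z₂ : ℂ} (h₁ : OffLattice τ z₁)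
    (h₂ : OffLattice τ z₂) :
    PhiTilde m τ z₁ z₂ 0 = appell (m + 1) τ ((z₁ - z₂) / 2) (z₁ + z₂)
      - appell (m + 1) τ ((z₁ - z₂) / 2) (-(z₁ + z₂)) := by
  have hn : 0 < m + 1 := m.succ_pos
  have e₁ : (z₁ - z₂) / 2 + (z₁ + z₂) / 2 = z₁ := by ring
  have e₂ : (z₁ - z₂) / 2 + -(z₁ + z₂) / 2 = -z₂ := by ring
  have H₁ := hasSum_appell hn hτ (w := (z₁ - z₂) / 2) (s := z₁ + z₂) (by rw [e₁]; exact h₁)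
  have H₂ := hasSum_appell hn hτ (w := (z₁ - z₂) / 2) (s := -(z₁ + z₂)) (by rw [e₂]; exact h₂.neg)
  rw [e₁] at H₁
  rw [e₂] at H₂
  -- `hasSum_appell` yields `x/(1 - x)`, one less than the wanted `1/(1 - x)`. The missing theta
  -- series is even in `s`, so it cancels in the difference.
  have C₁ := (summable_appell_coeff hn hτ (z₁ + z₂)).hasSum
  have C₂ : HasSum (fun l : ℤ => ee ((m + 1 : ℕ) * l * (-(z₁ + z₂)) + (m + 1 : ℕ) * l ^ 2 * τ))
      (∑' l : ℤ, ee ((m + 1 : ℕ) * l * (z₁ + z₂) + (m + 1 : ℕ) * l ^ 2 * τ)) := by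
    convert! (Equiv.neg ℤ).hasSum_iff.mpr C₁ using 1
    funext l
    simp only [Function.comp, Equiv.neg_apply]
    congr 1
    push_cast
    ring
  have hΦ := (H₁.add C₁).sub (H₂.add C₂)
  have hPhi : Phi m τ z₁ z₂ 0 = ∑' l : ℤ,
      (ee ((m + 1 : ℕ) * l * (z₁ + z₂) + (m + 1 : ℕ) * l ^ 2 * τ) / (1 - ee (z₁ + l * τ))
        - ee ((m + 1 : ℕ) * l * (z₁ + z₂) + (m + 1 : ℕ) * l ^ 2 * τ)
        + ee ((m + 1 : ℕ) * l * (z₁ + z₂) + (m + 1 : ℕ) * l ^ 2 * τ)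
        - (ee ((m + 1 : ℕ) * l * -(z₁ + z₂) + (m + 1 : ℕ) * l ^ 2 * τ) / (1 - ee (-z₂ + l * τ))
        - ee ((m + 1 : ℕ) * l * -(z₁ + z₂) + (m + 1 : ℕ) * l ^ 2 * τ)
        + ee ((m + 1 : ℕ) * l * -(z₁ + z₂) + (m + 1 : ℕ) * l ^ 2 * τ))) := by
    rw [Phi, mul_zero, ee_zero, one_mul]
    refine tsum_congr fun l => ?_
    simp only [qpow_eq_ee, ← ee_add, sub_add_cancel]
    push_cast
    congr 3
    · ring
    · ring_nf
    · ring
    · ring_nf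
  rw [PhiTilde, hPhi, hΦ.tsum_eq, PhiAdd, mul_zero, ee_zero]
  have hTh : ∀ j : ℕ, Theta (-j) (m + 1) τ (-(z₁ + z₂)) = Theta j (m + 1) τ (z₁ + z₂) :=
    fun j => Theta_neg j (m + 1) τ (z₁ + z₂)
  simp only [hTh, mul_sub, Finset.sum_sub_distrib]
  rw [show 2 * (m + 1) = 2 * m + 2 by ring]
  ring

theorem OffLattice.add {τ z : ℂ} (h : OffLattice τ z) (a b : ℤ) :
    OffLattice τ (z + a + b * τ) := by
  intro x y hz
  refine h (x - a) (y - b) ?_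
  push_cast
  linear_combination hz

theorem OffLattice.mul {τ z : ℂ} (h : OffLattice τ z) (M : ℕ) : OffLattice (M * τ) z := by
  intro x y hz
  refine h x (y * M) ?_
  push_cast
  linear_combination hz

theorem OffLattice.add_tau {τ z : ℂ} (h : OffLattice τ z) (k : ℤ) : OffLattice (τ + k) z := by
  intro x y hz
  refine h (x + y * k) y ?_
  push_cast
  linear_combination hz

theorem OffLattice.inv {τ z : ℂ} (hτ : τ ≠ 0) (h : OffLattice τ z) :
    OffLattice (-1 / τ) (z / τ) := by
  intro x y hz
  refine h (-y) x ?_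
  field_simp at hz
  push_cast
  linear_combination hz

theorem OffLattice.div {τ z : ℂ} {M : ℕ} (hM : 0 < M) (h : OffLattice τ z) :
    OffLattice (τ / M) (z / M) := by
  have hMC : (M : ℂ) ≠ 0 := Nat.cast_ne_zero.mpr hM.ne'
  intro x y hz
  refine h (x * M) y ?_
  field_simp at hz
  push_cast
  linear_combination hz

theorem appell_add_tau (n : ℕ) (τ w s : ℂ) (k : ℤ) : appell n (τ + k) w s = appell n τ w s := by
  rw [appell, appell]
  refine tsum_congr fun l => ?_
  have e1 : (τ + k).im = τ.im := by simp
  have e2 : w + s / 2 + l * (τ + k) = w + s / 2 + l * τ + (l * k : ℤ) := by push_cast; ring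
  rw [e1, e2, kernel_add_int]
  congr 1
  exact ee_congr (n * l ^ 2 * k) (by push_cast; ring)

theorem half_sub_add (z₁ z₂ : ℂ) : (z₁ - z₂) / 2 + (z₁ + z₂) / 2 = z₁ := by ring

theorem half_sub_add_neg (z₁ z₂ : ℂ) : (z₁ - z₂) / 2 + -(z₁ + z₂) / 2 = -z₂ := by ring

section PhiTilde

variable (m : ℕ) {τ : ℂ} (hτ : 0 < τ.im) {z₁ z₂ : ℂ} (h₁ : OffLattice τ z₁) (h₂ : OffLattice τ z₂)

include hτ h₁ h₂

theorem PhiTilde_add_tau (k : ℤ) : PhiTilde m (τ + k) z₁ z₂ 0 = PhiTilde m τ z₁ z₂ 0 := by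
  rw [PhiTilde_eq m hτ h₁ h₂, PhiTilde_eq m (by simpa using hτ) (h₁.add_tau k) (h₂.add_tau k),
    appell_add_tau, appell_add_tau]

theorem PhiTilde_neg_swap : PhiTilde m τ (-z₂) (-z₁) 0 = -PhiTilde m τ z₁ z₂ 0 := by
  rw [PhiTilde_eq m hτ h₁ h₂, PhiTilde_eq m hτ h₂.neg h₁.neg]
  have e1 : (-z₂ - -z₁) / 2 = (z₁ - z₂) / 2 := by ring
  have e2 : -z₂ + -z₁ = -(z₁ + z₂) := by ring
  rw [e1, e2, neg_neg]
  ring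

theorem PhiTilde_add_int (a b : ℤ) : PhiTilde m τ (z₁ + a) (z₂ + b) 0 = PhiTilde m τ z₁ z₂ 0 := by
  have h₁' := h₁.add a 0
  have h₂' := h₂.add b 0
  simp only [Int.cast_zero, zero_mul, add_zero] at h₁' h₂'
  rw [PhiTilde_eq m hτ h₁ h₂, PhiTilde_eq m hτ h₁' h₂']
  have H1 := appell_add_int (m + 1) (τ := τ) ((z₁ - z₂) / 2) (z₁ + z₂) a (a + b)
  have H2 := appell_add_int (m + 1) (τ := τ) ((z₁ - z₂) / 2) (-(z₁ + z₂)) (-b) (-(a + b))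
  rw [← H1, ← H2]
  congr 2 <;> (push_cast; ring)

theorem PhiTilde_add_mul (a b : ℤ) :
    PhiTilde m τ (z₁ + a * τ) (z₂ + b * τ) 0
      = ee (-((m + 1) * (b * z₁ + a * z₂)) - (m + 1) * a * b * τ) * PhiTilde m τ z₁ z₂ 0 := by
  have h₁' := h₁.add 0 a
  have h₂' := h₂.add 0 b
  simp only [Int.cast_zero, add_zero] at h₁' h₂'
  rw [PhiTilde_eq m hτ h₁ h₂, PhiTilde_eq m hτ h₁' h₂']
  have H1 := appell_add_mul (n := m + 1) m.succ_pos hτ (w := (z₁ - z₂) / 2) (s := z₁ + z₂)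
    (by rw [half_sub_add]; exact h₁) a (a + b)
  have H2 := appell_add_mul (n := m + 1) m.succ_pos hτ (w := (z₁ - z₂) / 2) (s := -(z₁ + z₂))
    (by rw [half_sub_add_neg]; exact h₂.neg) (-b) (-(a + b))
  have e1 : (z₁ - z₂) / 2 + (2 * a - (a + b) : ℤ) * τ / 2 = (z₁ + a * τ - (z₂ + b * τ)) / 2 := by
    push_cast; ring
  have e2 : (z₁ - z₂) / 2 + (2 * (-b) - -(a + b) : ℤ) * τ / 2
      = (z₁ + a * τ - (z₂ + b * τ)) / 2 := by
    push_cast; ring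
  have e3 : z₁ + z₂ + (a + b : ℤ) * τ = z₁ + a * τ + (z₂ + b * τ) := by push_cast; ring
  have e4 : -(z₁ + z₂) + (-(a + b) : ℤ) * τ = -(z₁ + a * τ + (z₂ + b * τ)) := by push_cast; ring
  rw [e1, e3] at H1
  rw [e2, e4] at H2
  rw [H1, H2, mul_sub]
  push_cast
  ring_nf

theorem PhiTilde_S :
    PhiTilde m (-1 / τ) (z₁ / τ) (z₂ / τ) 0
      = τ * ee ((m + 1) * z₁ * z₂ / τ) * PhiTilde m τ z₁ z₂ 0 := by
  have h0 : τ ≠ 0 := fun h => by simp [h] at hτ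
  rw [PhiTilde_eq m hτ h₁ h₂, PhiTilde_eq m (im_neg_one_div_pos hτ) (h₁.inv h0) (h₂.inv h0)]
  have H1 := appell_S (n := m + 1) m.succ_pos hτ (w := (z₁ - z₂) / 2) (s := z₁ + z₂)
    (by rw [half_sub_add]; exact h₁)
  have H2 := appell_S (n := m + 1) m.succ_pos hτ (w := (z₁ - z₂) / 2) (s := -(z₁ + z₂))
    (by rw [half_sub_add_neg]; exact h₂.neg)
  have e1 : (z₁ - z₂) / 2 / τ = (z₁ / τ - z₂ / τ) / 2 := by ring
  have e2 : (z₁ + z₂) / τ = z₁ / τ + z₂ / τ := by ring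
  have e3 : -(z₁ + z₂) / τ = -(z₁ / τ + z₂ / τ) := by ring
  rw [e1, e2] at H1
  rw [e1, e3] at H2
  rw [H1, H2, mul_sub]
  push_cast
  ring_nf

theorem PhiTilde_div {M : ℕ} (hM : 0 < M) (hnM : Nat.Coprime (m + 1) M) :
    PhiTilde m (τ / M) (z₁ / M) (z₂ / M) 0
      = ∑ a ∈ Finset.range M, ∑ d ∈ Finset.range M,
        ee ((m + 1) / M * ((a + d) * z₁ + a * z₂) + (m + 1) * (a * (a + d)) / M * τ)
          * PhiTilde m (M * τ) (z₁ + a * τ) (z₂ + (a + d) * τ) 0 := by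
  have : NeZero M := ⟨hM.ne'⟩
  have hM' : (0 : ℝ) < M := Nat.cast_pos.mpr hM
  have hMC : (M : ℂ) ≠ 0 := Nat.cast_ne_zero.mpr hM.ne'
  have himM : 0 < (M * τ).im := by
    rw [← Complex.ofReal_natCast, Complex.im_ofReal_mul]; positivity
  have himd : 0 < (τ / M).im := by
    rw [← Complex.ofReal_natCast, Complex.div_ofReal_im]; positivity
  rw [PhiTilde_eq m himd (h₁.div hM) (h₂.div hM)]
  set w := (z₁ - z₂) / 2 with hw
  set s := z₁ + z₂ with hs
  have H1 := appell_div (n := m + 1) m.succ_pos hτ hM hnM (w := w) (s := s)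
    (by rw [half_sub_add]; exact h₁)
  have H2 := appell_div (n := m + 1) m.succ_pos hτ hM hnM (w := w) (s := -s)
    (by rw [half_sub_add_neg]; exact h₂.neg)
  have e1 : w / M = (z₁ / M - z₂ / M) / 2 := by rw [hw]; ring
  have e2 : s / M = z₁ / M + z₂ / M := by rw [hs]; ring
  have e3 : -s / M = -(z₁ / M + z₂ / M) := by rw [hs]; ring
  rw [e1, e2] at H1
  rw [e1, e3] at H2
  -- In the copy with `-s` the index `a` is replaced by `-d - a`, which turns `2a + d` into its
  -- negative. Then both copies are evaluated at the same translated arguments and recombine into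
  -- `PhiTilde`.
  have hflip : ∀ d : ℕ, ∑ a ∈ Finset.range M,
        ee ((m + 1 : ℕ) / M * (d * w + (2 * a + d) * -s / 2) + (m + 1 : ℕ) * (a * (a + d)) / M * τ)
          * appell (m + 1) (M * τ) (w - d * τ / 2) (-s + (2 * a + d) * τ)
      = ∑ a ∈ Finset.range M,
        ee ((m + 1 : ℕ) / M * (d * w + (2 * a + d) * s / 2) + (m + 1 : ℕ) * (a * (a + d)) / M * τ)
          * appell (m + 1) (M * τ) (w - d * τ / 2) (-(s + (2 * a + d) * τ)) := by
    intro d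
    set f : ℤ → ℂ := fun a =>
        ee ((m + 1 : ℕ) / M * (d * w + (2 * a + d) * -s / 2) + (m + 1 : ℕ) * (a * (a + d)) / M * τ)
          * appell (m + 1) (M * τ) (w - d * τ / 2) (-s + (2 * a + d) * τ) with hf
    have hper : ∀ a, f (a + M) = f a := by
      intro a
      have hreg : ∀ x y : ℤ, w - d * τ / 2 + (-s + (2 * a + d) * τ) / 2 ≠ x + y * (M * τ) := by
        have h := (h₂.neg.add 0 a).mul M
        intro x y hxy
        refine h x y ?_
        rw [← hxy, hw, hs]
        push_cast; ring
      have H := appell_add_mul (n := m + 1) m.succ_pos himM hreg 1 2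
      have e4 : w - d * τ / 2 + (2 * 1 - 2 : ℤ) * (M * τ) / 2 = w - d * τ / 2 := by
        push_cast; ring
      have e5 : -s + (2 * a + d) * τ + (2 : ℤ) * (M * τ)
          = -s + (2 * (a + M : ℤ) + d) * τ := by push_cast; ring
      rw [e4, e5] at H
      simp only [hf]
      rw [H, ← mul_assoc, ← ee_add]
      congr 2
      push_cast
      field_simp
      ring
    have h := sum_range_periodic hper (-d) (c := -1) (by simp)
    have e6 : ∀ a : ℕ, f (-d + -1 * a) =
        ee ((m + 1 : ℕ) / M * (d * w + (2 * a + d) * s / 2) + (m + 1 : ℕ) * (a * (a + d)) / M * τ)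
          * appell (m + 1) (M * τ) (w - d * τ / 2) (-(s + (2 * a + d) * τ)) := by
      intro a
      simp only [hf]
      congr 2 <;> (push_cast; ring)
    rw [Finset.sum_congr rfl fun a _ => (e6 a).symm, h]
    simp [hf]
  rw [H1, H2, Finset.sum_comm (s := Finset.range M) (t := Finset.range M)]
  rw [Finset.sum_comm (s := Finset.range M) (t := Finset.range M)
    (f := fun a d => ee ((m + 1 : ℕ) / M * (d * w + (2 * a + d) * -s / 2)
      + (m + 1 : ℕ) * (a * (a + d)) / M * τ)
      * appell (m + 1) (M * τ) (w - d * τ / 2) (-s + (2 * a + d) * τ)),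
    Finset.sum_congr rfl fun d _ => hflip d, ← Finset.sum_sub_distrib, Finset.sum_comm
      (s := Finset.range M) (t := Finset.range M) (f := fun a d =>
        ee ((m + 1) / M * ((a + d) * z₁ + a * z₂) + (m + 1) * (a * (a + d)) / M * τ)
          * PhiTilde m (M * τ) (z₁ + a * τ) (z₂ + (a + d) * τ) 0)]
  refine Finset.sum_congr rfl fun d _ => ?_
  rw [← Finset.sum_sub_distrib]
  refine Finset.sum_congr rfl fun a _ => ?_
  have h₁' := (h₁.add 0 a).mul M
  have h₂' := (h₂.add 0 (a + d)).mul M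
  simp only [Int.cast_zero, add_zero, Int.cast_natCast, Int.cast_add] at h₁' h₂'
  rw [PhiTilde_eq m himM h₁' h₂', ← mul_sub]
  have e7 : (z₁ + a * τ - (z₂ + (a + d) * τ)) / 2 = w - d * τ / 2 := by rw [hw]; ring
  have e8 : z₁ + a * τ + (z₂ + (a + d) * τ) = s + (2 * a + d) * τ := by rw [hs]; ring
  rw [e7, e8]
  congr 2
  rw [hw, hs]
  push_cast
  ring

end PhiTilde

/-! ### The numerators: inversion and folding onto the index set -/

theorem two_mul_half (e : Fin 2) : 2 * (half e : ℂ) = ((e.val : ℤ) : ℂ) := by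
  rw [half]; push_cast; ring

theorem IsRegular.off_neg {e e' : Fin 2} {τ z : ℂ} (h : IsRegular e e' τ z) (x : ℤ) :
    OffLattice τ (-z + ((half e' + x : ℚ) : ℂ) * τ + half e) := by
  intro a b hab
  refine h (-a) (x - b) ?_
  push_cast at hab ⊢
  linear_combination -hab

/-- Since `2ε` and `2ε'` are integers, the excluded coset is symmetric under negation. -/
theorem IsRegular.off {e e' : Fin 2} {τ z : ℂ} (h : IsRegular e e' τ z) (x : ℤ) :
    OffLattice τ (z + ((half e' + x : ℚ) : ℂ) * τ + half e) := by
  intro a b hab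
  have h1 := two_mul_half e
  have h2 := two_mul_half e'
  refine h (a - e.val) (b - x - e'.val) ?_
  push_cast at hab h1 h2 ⊢
  linear_combination hab - h1 - h2 * τ

section Psi

variable (M m : ℕ) (e e' : Fin 2) {τ z : ℂ}

theorem PsiTilde_neg_swap (hM : 0 < M) (hτ : 0 < τ.im) (hz : IsRegular e e' τ z) (x y : ℤ) :
    PsiTilde M m e (-(half e' + y)) (-(half e' + x)) τ (-z) z 0
      = -PsiTilde M m e (half e' + x) (half e' + y) τ (-z) z 0 := by
  have hM' : (0 : ℝ) < M := Nat.cast_pos.mpr hM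
  have himM : 0 < (M * τ).im := by
    rw [← Complex.ofReal_natCast, Complex.im_ofReal_mul]; positivity
  have h1 := (hz.off_neg x).mul M
  have h2 := (hz.off y).mul M
  have hsw := PhiTilde_neg_swap m himM h1 h2
  have hint := PhiTilde_add_int m himM h2.neg h1.neg e.val e.val
  have he := two_mul_half e
  simp only [PsiTilde, zero_div]
  have e1 : -z + ((-(half e' + y) : ℚ) : ℂ) * τ + half e
      = -(z + ((half e' + y : ℚ) : ℂ) * τ + half e) + (e.val : ℤ) := by
    rw [← he]; push_cast; ring
  have e2 : z + ((-(half e' + x) : ℚ) : ℂ) * τ + half e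
      = -(-z + ((half e' + x : ℚ) : ℂ) * τ + half e) + (e.val : ℤ) := by
    rw [← he]; push_cast; ring
  rw [e1, e2, hint, hsw, mul_neg]
  congr 3
  · congr 1; push_cast; ring
  · congr 1; push_cast; ring

/-- These are the labels with `j + k = 0`, fixed by the swap `(j, k) ↦ (-k, -j)` under which the
numerator is odd. -/
theorem PsiTilde_eq_zero (hM : 0 < M) (hτ : 0 < τ.im) (hz : IsRegular e e' τ z) {x y : ℤ}
    (hxy : x + y + e'.val = 0) :
    PsiTilde M m e (half e' + x) (half e' + y) τ (-z) z 0 = 0 := by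
  have h := PsiTilde_neg_swap M m e e' hM hτ hz x y
  have hq : (half e' + y : ℚ) = -(half e' + x) := by
    have h1 : ((x + y + e'.val : ℤ) : ℚ) = 0 := by rw [hxy]; simp
    have h2 : 2 * half e' = e'.val := by rw [half]; ring
    push_cast at h1
    linarith
  rw [hq, neg_neg] at h
  rw [hq]
  exact self_eq_neg.mp h

/-- The terms of the double sum in the inversion formula for `PsiTilde`. -/
def psiSTerm (j k : ℚ) (τ z : ℂ) (x y : ℤ) : ℂ :=
  ee (-((m + 1) / M * ((half e' + y) * j + (half e' + x) * k)))
    * PsiTilde M m e (half e' + x) (half e' + y) τ (-z) z 0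

/-- The elliptic factor of `PhiTilde` and the prefactors leave only the phase `ee (-(m+1)(k + ε))`.
It is trivial because `k ∈ ε + ℤ`, which is the reason for restricting `k` and not `j`. -/
theorem psiSTerm_add_left (hM : 0 < M) (hτ : 0 < τ.im) (hz : IsRegular e e' τ z) (j : ℚ) (k₀ : ℤ)
    (x y : ℤ) : psiSTerm M m e e' j (half e + k₀) τ z (x + M) y
      = psiSTerm M m e e' j (half e + k₀) τ z x y := by
  have hMC : (M : ℂ) ≠ 0 := Nat.cast_ne_zero.mpr hM.ne'
  have hM' : (0 : ℝ) < M := Nat.cast_pos.mpr hM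
  have himM : 0 < (M * τ).im := by
    rw [← Complex.ofReal_natCast, Complex.im_ofReal_mul]; positivity
  have h1 := (hz.off_neg x).mul M
  have h2 := (hz.off y).mul M
  have hadd := PhiTilde_add_mul m himM h1 h2 1 0
  have he := two_mul_half e
  simp only [psiSTerm, PsiTilde, zero_div]
  have e1 : -z + ((half e' + (x + M : ℤ) : ℚ) : ℂ) * τ + half e
      = -z + ((half e' + x : ℚ) : ℂ) * τ + half e + (1 : ℤ) * (M * τ) := by
    push_cast; ring
  have e2 : z + ((half e' + y : ℚ) : ℂ) * τ + half e
      = z + ((half e' + y : ℚ) : ℂ) * τ + half e + (0 : ℤ) * (M * τ) := by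
    push_cast; ring
  rw [e1]
  nth_rewrite 1 [e2]
  rw [hadd]
  simp only [qpow_eq_ee, ← mul_assoc, ← ee_add]
  congr 1
  refine ee_congr (-((m + 1) * (k₀ + e.val))) ?_
  push_cast at he ⊢
  rw [← he]
  field_simp
  ring

theorem psiSTerm_add_right (hM : 0 < M) (hτ : 0 < τ.im) (hz : IsRegular e e' τ z) (j₀ : ℤ) (k : ℚ)
    (x y : ℤ) : psiSTerm M m e e' (half e + j₀) k τ z x (y + M)
      = psiSTerm M m e e' (half e + j₀) k τ z x y := by
  have hMC : (M : ℂ) ≠ 0 := Nat.cast_ne_zero.mpr hM.ne'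
  have hM' : (0 : ℝ) < M := Nat.cast_pos.mpr hM
  have himM : 0 < (M * τ).im := by
    rw [← Complex.ofReal_natCast, Complex.im_ofReal_mul]; positivity
  have h1 := (hz.off_neg x).mul M
  have h2 := (hz.off y).mul M
  have hadd := PhiTilde_add_mul m himM h1 h2 0 1
  have he := two_mul_half e
  simp only [psiSTerm, PsiTilde, zero_div]
  have e1 : z + ((half e' + (y + M : ℤ) : ℚ) : ℂ) * τ + half e
      = z + ((half e' + y : ℚ) : ℂ) * τ + half e + (1 : ℤ) * (M * τ) := by
    push_cast; ring
  have e2 : -z + ((half e' + x : ℚ) : ℂ) * τ + half e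
      = -z + ((half e' + x : ℚ) : ℂ) * τ + half e + (0 : ℤ) * (M * τ) := by
    push_cast; ring
  rw [e1]
  nth_rewrite 1 [e2]
  rw [hadd]
  simp only [qpow_eq_ee, ← mul_assoc, ← ee_add]
  congr 1
  refine ee_congr (-((m + 1) * (j₀ + e.val))) ?_
  push_cast at he ⊢
  rw [← he]
  field_simp
  ring

/-- The inversion formula for `PsiTilde`, with the sum over all residues modulo `M`. -/
theorem PsiTilde_S (hM : 0 < M) (hnM : Nat.Coprime (m + 1) M) (hτ : 0 < τ.im)
    (hz : IsRegular e' e τ z) (j₀ k₀ : ℤ) :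
    PsiTilde M m e (half e' + j₀) (half e' + k₀) (-1 / τ) (-(z / τ)) (z / τ) 0
      = τ / M * ee (-((m + 1) * z ^ 2 / (M * τ))) * ∑ a ∈ Finset.range M, ∑ d ∈ Finset.range M,
          psiSTerm M m e' e (half e' + j₀) (half e' + k₀) τ z a (a + d) := by
  have h0 : τ ≠ 0 := fun h => by simp [h] at hτ
  have hMC : (M : ℂ) ≠ 0 := Nat.cast_ne_zero.mpr hM.ne'
  have hM' : (0 : ℝ) < M := Nat.cast_pos.mpr hM
  have himM : 0 < (M * τ).im := by
    rw [← Complex.ofReal_natCast, Complex.im_ofReal_mul]; positivity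
  have himd : 0 < (τ / M).im := by
    rw [← Complex.ofReal_natCast, Complex.div_ofReal_im]; positivity
  have he := two_mul_half e'
  -- These are the arguments obtained after clearing the scaling: `M(-1/τ) = -1/(τ/M)`, so inversion
  -- applies at `τ/M` and division at `τ`. Modulo integers they are the arguments of the numerators
  -- at `τ`.
  set Z₁ : ℂ := -z - (half e' + j₀) + half e * τ with hZ₁
  set Z₂ : ℂ := z - (half e' + k₀) + half e * τ with hZ₂
  have hshift₁ : ∀ x : ℤ, Z₁ + x * τ
      = -z + ((half e + x : ℚ) : ℂ) * τ + half e' + (-(j₀ + e'.val) : ℤ) := by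
    intro x
    rw [hZ₁]; push_cast at he ⊢; linear_combination -he
  have hshift₂ : ∀ x : ℤ, Z₂ + x * τ
      = z + ((half e + x : ℚ) : ℂ) * τ + half e' + (-(k₀ + e'.val) : ℤ) := by
    intro x
    rw [hZ₂]; push_cast at he ⊢; linear_combination -he
  have hoff₁ : OffLattice τ Z₁ := by
    have h := (hz.off_neg 0).add (-(j₀ + e'.val)) 0
    have h' := hshift₁ 0
    rw [Int.cast_zero, zero_mul, add_zero] at h'
    rw [h']
    simpa using h
  have hoff₂ : OffLattice τ Z₂ := by
    have h := (hz.off 0).add (-(k₀ + e'.val)) 0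
    have h' := hshift₂ 0
    rw [Int.cast_zero, zero_mul, add_zero] at h'
    rw [h']
    simpa using h
  have hS := PhiTilde_S m himd (hoff₁.div hM) (hoff₂.div hM)
  rw [PhiTilde_div m hτ hoff₁ hoff₂ hM hnM] at hS
  have e0 : (M : ℂ) * (-1 / τ) = -1 / (τ / M) := by field_simp
  have e1 : -(z / τ) + ((half e' + j₀ : ℚ) : ℂ) * (-1 / τ) + half e = Z₁ / M / (τ / M) := by
    rw [hZ₁]; push_cast; field_simp; ring
  have e2 : z / τ + ((half e' + k₀ : ℚ) : ℂ) * (-1 / τ) + half e = Z₂ / M / (τ / M) := by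
    rw [hZ₂]; push_cast; field_simp; ring
  rw [PsiTilde, zero_div, e0, e1, e2, hS, Finset.mul_sum, Finset.mul_sum, Finset.mul_sum]
  refine Finset.sum_congr rfl fun a _ => ?_
  rw [Finset.mul_sum, Finset.mul_sum, Finset.mul_sum]
  refine Finset.sum_congr rfl fun d _ => ?_
  have hint := PhiTilde_add_int m himM ((hz.off_neg a).mul M) ((hz.off (a + d)).mul M)
    (-(j₀ + e'.val)) (-(k₀ + e'.val))
  rw [← hshift₁, ← hshift₂] at hint
  push_cast at hint
  rw [psiSTerm, PsiTilde, zero_div]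
  push_cast
  rw [hint]
  simp only [qpow_eq_ee]
  generalize PhiTilde m _ _ _ 0 = P
  have hE : ∀ A B C D A' B' C' D' : ℂ, A + B + C + D = A' + B' + C' + D' →
      ee A * ee B * (τ / M * ee C * (ee D * P)) = τ / M * ee A' * (ee B' * (ee C' * ee D' * P)) := by
    intro A B C D A' B' C' D' h
    have : ee A * ee B * ee C * ee D = ee A' * ee B' * ee C' * ee D' := by
      simp only [← ee_add]; rw [h]
    linear_combination (τ / M * P) * this
  apply hE
  rw [hZ₁, hZ₂]
  field_simp
  ring

end Psi

/-- Folding a sum over `(ℤ/M)²` along the involution `(x, y) ↦ (-y - e, -x - e)`. -/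
theorem sum_fold (K : ℕ) (e : ℤ) {F : ℤ → ℤ → ℂ}
    (h₁ : ∀ x y, F (x + (K + 1 : ℕ)) y = F x y) (h₂ : ∀ x y, F x (y + (K + 1 : ℕ)) = F x y)
    (h₀ : ∀ x y, x + y + e = 0 → F x y = 0) :
    ∑ a ∈ Finset.range (K + 1), ∑ d ∈ Finset.range (K + 1), F a (a + d)
      = ∑ c ∈ Finset.range K, ∑ a ∈ Finset.range (c + 1),
        (F (a + 1 - e) (c - a) + F (-(c - a) - e) (-a - 1)) := by
  have s1 : ∀ a : ℕ, ∑ d ∈ Finset.range (K + 1), F a (a + d)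
      = ∑ c ∈ Finset.range (K + 1), F a (c - e - a) := by
    intro a
    have hA := sum_range_periodic (h₂ a) a (c := 1) (by simp)
    have hB := sum_range_periodic (h₂ a) (-e - a) (c := 1) (by simp)
    simp only [one_mul] at hA hB
    rw [hA, ← hB]
    refine Finset.sum_congr rfl fun c _ => ?_
    congr 1; ring
  -- On each antidiagonal `x + y + e = c`, `x` starts at `1 - e`, which makes the first label `ε +
  -- x` the least positive element of `ε + ℤ`.
  have s2 : ∀ c : ℕ, ∑ a ∈ Finset.range (K + 1), F a (c - e - a)
      = ∑ a ∈ Finset.range (K + 1), F (a + 1 - e) (c - 1 - a) := by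
    intro c
    have hper : ∀ x : ℤ, F (x + (K + 1 : ℕ)) (c - e - (x + (K + 1 : ℕ))) = F x (c - e - x) := by
      intro x
      rw [h₁, ← h₂ x (c - e - (x + (K + 1 : ℕ)))]
      congr 1; ring
    have hA := sum_range_periodic (f := fun x : ℤ => F x (c - e - x)) hper (1 - e) (c := 1)
      (by simp)
    simp only [one_mul] at hA
    rw [← hA]
    refine Finset.sum_congr rfl fun a _ => ?_
    congr 1 <;> ring
  rw [Finset.sum_congr rfl fun a _ => s1 a, Finset.sum_comm, Finset.sum_congr rfl fun c _ => s2 c,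
    Finset.sum_range_succ']
  have hz : ∑ a ∈ Finset.range (K + 1), F (a + 1 - e) ((0 : ℕ) - 1 - a) = 0 :=
    Finset.sum_eq_zero fun a _ => h₀ _ _ (by push_cast; ring)
  rw [hz, add_zero]
  -- The first `c + 1` points of an antidiagonal represent labels in `Omega`. The others are, mod `K
  -- + 1`, the images under the involution of the representatives on the antidiagonal numbered `K -
  -- 1 - c`.
  have s3 : ∀ c ∈ Finset.range K, ∑ a ∈ Finset.range (K + 1), F (a + 1 - e) ((c + 1 : ℕ) - 1 - a)
      = ∑ a ∈ Finset.range (c + 1), F (a + 1 - e) (c - a)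
        + ∑ a ∈ Finset.range (K - 1 - c + 1), F (-((K - 1 - c : ℕ) - a) - e) (-a - 1) := by
    intro c hc
    have hcK := Finset.mem_range.mp hc
    rw [show K + 1 = (c + 1) + (K - 1 - c + 1) by omega, Finset.sum_range_add]
    congr 1
    · refine Finset.sum_congr rfl fun a _ => ?_
      congr 1; push_cast; ring
    · refine Finset.sum_congr rfl fun a _ => ?_
      rw [← h₁ (-((K - 1 - c : ℕ) - a) - e)]
      have : ((K - 1 - c : ℕ) : ℤ) = K - 1 - c := by omega
      rw [this]
      congr 1 <;> (push_cast; ring)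
  rw [Finset.sum_congr rfl s3, Finset.sum_add_distrib]
  rw [Finset.sum_range_reflect
    (fun c : ℕ => ∑ a ∈ Finset.range (c + 1), F (-((c : ℕ) - a) - e) (-a - 1)) K,
    ← Finset.sum_add_distrib]
  exact Finset.sum_congr rfl fun c _ => Finset.sum_add_distrib.symm

theorem sum_Omega (K : ℕ) (e : Fin 2) (h : ℚ × ℚ → ℂ) :
    ∑ r ∈ Omega (K + 1) e, h r = ∑ c ∈ Finset.range K, ∑ a ∈ Finset.range (c + 1),
      h (half e + (a + 1 - e.val : ℤ), half e + (c - a : ℤ)) := by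
  have hhalf : half e = (e.val : ℚ) / 2 := rfl
  have he : e.val ≤ 1 := by omega
  rw [Finset.sum_sigma']
  symm
  refine Finset.sum_bij (fun p _ => (half e + (p.2 + 1 - e.val : ℤ), half e + (p.1 - p.2 : ℤ)))
    ?_ ?_ ?_ ?_
  · rintro ⟨c, a⟩ hp
    simp only [Finset.mem_sigma, Finset.mem_range] at hp
    rw [mem_Omega]
    refine ⟨⟨a + 1 - e.val, c - a, ?_, ?_⟩, ?_, ?_⟩
    · simp only
      have : ((a + 1 - e.val : ℕ) : ℤ) = a + 1 - e.val := by omega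
      rw [← this]; simp
    · simp only
      have : ((c - a : ℕ) : ℤ) = c - a := by omega
      rw [← this]; simp
    · have : (c : ℚ) + 1 ≤ K := by exact_mod_cast hp.1
      simp only [hhalf]
      push_cast
      linarith
    · have h1 : (e.val : ℚ) ≤ 1 := by exact_mod_cast he
      have h2 : (0 : ℚ) ≤ a := a.cast_nonneg
      simp only [hhalf]
      push_cast
      linarith
  · rintro ⟨c, a⟩ _ ⟨c', a'⟩ _ heq
    simp only [Prod.mk.injEq, add_right_inj, Int.cast_inj] at heq
    have h1 : a = a' := by omega
    have h2 : c = c' := by omega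
    rw [h1, h2]
  · rintro ⟨x, y⟩ hr
    rw [mem_Omega] at hr
    obtain ⟨⟨a, b, hx, hy⟩, hsum, hpos⟩ := hr
    simp only at hx hy hsum hpos
    subst hx hy
    have hpos' : 0 < e.val + 2 * a := by
      have h1 : (0 : ℚ) < e.val + 2 * a := by rw [hhalf] at hpos; linarith
      exact_mod_cast h1
    have hsum' : a + b + e.val ≤ K := by
      have h1 : (a : ℚ) + b + e.val ≤ K := by
        rw [hhalf] at hsum; push_cast at hsum; linarith
      exact_mod_cast h1
    refine ⟨⟨a + e.val - 1 + b, a + e.val - 1⟩, ?_, ?_⟩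
    · simp only [Finset.mem_sigma, Finset.mem_range]
      omega
    · have h1 : ((a + e.val - 1 : ℕ) : ℤ) + 1 - e.val = a := by omega
      have h2 : ((a + e.val - 1 + b : ℕ) : ℤ) - (a + e.val - 1 : ℕ) = b := by omega
      simp only [h1, h2]
      simp
  · intro p _
    rfl

theorem ee_sub_ee (A B : ℂ) :
    ee (-A) - ee B = -2 * I * (Complex.exp (π * I * (B - A)) * Complex.sin (π * (A + B))) := by
  rw [Complex.sin]
  have h1 : ee (-A) = Complex.exp (π * I * (B - A)) * Complex.exp (-(π * (A + B)) * I) := by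
    rw [ee, ← Complex.exp_add]; congr 1; ring
  have h2 : ee B = Complex.exp (π * I * (B - A)) * Complex.exp (π * (A + B) * I) := by
    rw [ee, ← Complex.exp_add]; congr 1; ring
  rw [h1, h2]
  linear_combination (Complex.exp (π * I * (B - A)) * (Complex.exp (-(π * (A + B)) * I)
    - Complex.exp (π * (A + B) * I))) * Complex.I_sq

/-- The inversion formula for `PsiTilde`. -/
theorem PsiTilde_S_Omega (M m : ℕ) (e e' : Fin 2) {τ z : ℂ} (hM : 0 < M)
    (hnM : Nat.Coprime (m + 1) M) (hτ : 0 < τ.im) (hz : IsRegular e' e τ z) (j₀ k₀ : ℤ)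
    (j k : ℚ) (hj : j = half e' + j₀) (hk : k = half e' + k₀) :
    PsiTilde M m e j k (-1 / τ) (-(z / τ)) (z / τ) 0
      = -2 * I * τ / M * ee (-((m + 1) * z ^ 2 / (M * τ))) * ∑ r ∈ Omega M e,
          Complex.exp (π * I * (m + 1) / M * (j - k) * (r.1 - r.2))
            * Complex.sin ((m + 1) / M * (j + k) * (r.1 + r.2) * π)
            * PsiTilde M m e' r.1 r.2 τ (-z) z 0 := by
  obtain ⟨K, rfl⟩ : ∃ K, M = K + 1 := ⟨M - 1, by omega⟩
  subst hj hk
  rw [PsiTilde_S (K + 1) m e e' hM hnM hτ hz j₀ k₀,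
    sum_fold K e.val (psiSTerm_add_left (K + 1) m e' e hM hτ hz _ k₀)
      (psiSTerm_add_right (K + 1) m e' e hM hτ hz j₀ _)
      (fun x y hxy => by rw [psiSTerm, PsiTilde_eq_zero (K + 1) m e' e hM hτ hz hxy, mul_zero]),
    sum_Omega]
  rw [show ∀ A B S : ℂ, A * B * S = A * (B * S) from fun A B S => mul_assoc A B S,
    show ∀ B S : ℂ, -2 * I * τ / (K + 1 : ℕ) * B * S
      = τ / (K + 1 : ℕ) * (B * (-2 * I * S)) from fun B S => by ring]
  congr 2
  rw [Finset.mul_sum]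
  refine Finset.sum_congr rfl fun c _ => ?_
  rw [Finset.mul_sum]
  refine Finset.sum_congr rfl fun a _ => ?_
  have hsw := PsiTilde_neg_swap (K + 1) m e' e hM hτ hz (a + 1 - e.val) (c - a)
  have he : 2 * half e = e.val := by rw [half]; ring
  have e1 : half e + ((-(c - a) - e.val : ℤ) : ℚ) = -(half e + ((c - a : ℤ) : ℚ)) := by
    push_cast; linear_combination he
  have e2 : half e + ((-a - 1 : ℤ) : ℚ) = -(half e + ((a + 1 - e.val : ℤ) : ℚ)) := by
    push_cast; linear_combination he
  have e1' : (half e : ℂ) + ((-(c - a) - e.val : ℤ) : ℂ) = -(half e + ((c - a : ℤ) : ℂ)) := by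
    exact_mod_cast congrArg (fun q : ℚ => (q : ℂ)) e1
  have e2' : (half e : ℂ) + ((-a - 1 : ℤ) : ℂ) = -(half e + ((a + 1 - e.val : ℤ) : ℂ)) := by
    exact_mod_cast congrArg (fun q : ℚ => (q : ℂ)) e2
  rw [psiSTerm, psiSTerm, e1, e2, e1', e2', hsw]
  generalize PsiTilde (K + 1) m e' _ _ τ (-z) z 0 = P
  simp only []
  push_cast
  set x : ℂ := half e + (a + 1 - e.val)
  set y : ℂ := half e + (c - a)
  set j : ℂ := half e' + j₀
  set k : ℂ := half e' + k₀
  -- Oddness of the numerator makes the two folded terms a difference of exponentials with the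
  -- common factor `P`.
  have hd := ee_sub_ee ((m + 1) / (K + 1) * (y * j + x * k)) ((m + 1) / (K + 1) * (x * j + y * k))
  have h1 : (-((m + 1) / (K + 1) * (-x * j + -y * k)) : ℂ)
      = (m + 1) / (K + 1) * (x * j + y * k) := by ring
  have h2 : (π * I * ((m + 1) / (K + 1) * (x * j + y * k) - (m + 1) / (K + 1) * (y * j + x * k)) : ℂ)
      = π * I * (m + 1) / (K + 1) * (j - k) * (x - y) := by ring
  have h3 : (π * ((m + 1) / (K + 1) * (y * j + x * k) + (m + 1) / (K + 1) * (x * j + y * k)) : ℂ)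
      = (m + 1) / (K + 1) * (j + k) * (x + y) * π := by ring
  rw [h2, h3] at hd
  rw [h1]
  linear_combination P * hd

/-! ### Jacobi theta functions and the eta function -/

theorem jacobiTheta₂_eq_tsum_ee (ζ τ : ℂ) :
    jacobiTheta₂ ζ τ = ∑' N : ℤ, ee (N * ζ + N ^ 2 * τ / 2) := by
  rw [jacobiTheta₂]
  refine tsum_congr fun N => ?_
  rw [jacobiTheta₂_term, ee]
  congr 1
  ring

/-- Split the series of `jacobiTheta₂` by the parity of the index. The characteristic `b` weights
the odd part by `ee (b/2) = (-1)^b`. -/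
theorem Theta_two_add (a b : ℤ) {τ : ℂ} (hτ : 0 < τ.im) (z : ℂ) :
    Theta a 2 τ z + ee (b / 2) * Theta (a + 2) 2 τ z
      = ee (a ^ 2 * τ / 8 + a * z / 2) * jacobiTheta₂ (z + a * τ / 2 + b / 2) τ := by
  have hs : Summable fun N : ℤ => ee ((2 * N + a) ^ 2 * τ / 8 + (2 * N + a) * z / 2 + N * b / 2) := by
    have hα : 0 < (τ / 2).im := by simpa using hτ
    refine (summable_ee_quadratic hα (a * τ / 2 + z + b / 2) (a ^ 2 * τ / 8 + a * z / 2)).congr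
      fun N => ?_
    congr 1; ring
  have h := tsum_int_split (M := 2) hs
  rw [Finset.sum_range_succ, Finset.sum_range_one] at h
  rw [jacobiTheta₂_eq_tsum_ee, ← tsum_mul_left, Theta_eq two_pos, Theta_eq two_pos, ← tsum_mul_left]
  have e1 : ∀ N : ℤ, ee (a ^ 2 * τ / 8 + a * z / 2) * ee (N * (z + a * τ / 2 + b / 2)
      + N ^ 2 * τ / 2) = ee ((2 * N + a) ^ 2 * τ / 8 + (2 * N + a) * z / 2 + N * b / 2) := by
    intro N
    rw [← ee_add]; congr 1; ring
  rw [tsum_congr e1, h]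
  congr 1
  · refine tsum_congr fun k => ?_
    exact ee_congr (-(k * b)) (by push_cast; ring)
  · refine tsum_congr fun k => ?_
    rw [← ee_add]
    exact ee_congr (-(k * b)) (by push_cast; ring)

theorem ee_half : ee (1 / 2) = -1 := by
  rw [ee, ← Complex.exp_pi_mul_I]; congr 1; ring

theorem ee_neg_quarter : ee (-(1 / 4)) = -I := by
  rw [ee, show 2 * π * I * (-(1 / 4)) = ((-(π / 2) : ℝ) : ℂ) * I by push_cast; ring,
    Complex.exp_mul_I, ← Complex.ofReal_cos, ← Complex.ofReal_sin]
  simp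

theorem jacobi_eq (a b : Fin 2) {τ : ℂ} (hτ : 0 < τ.im) (z : ℂ) :
    jacobi a b τ z = I ^ (a.val * b.val) * (ee (a.val ^ 2 * τ / 8 + a.val * z / 2)
      * jacobiTheta₂ (z + a.val * τ / 2 + b.val / 2) τ) := by
  have h := Theta_two_add a.val b.val hτ z
  simp only [Int.cast_natCast] at h
  rw [← h]
  have h3 : Theta 3 2 τ z = Theta (-1) 2 τ z := by
    simpa using Theta_add_mul two_pos (-1) 1 τ z
  clear h
  have h2 : ee 2⁻¹ = -1 := by rw [← ee_half]; norm_num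
  fin_cases a <;> fin_cases b
  · simp [jacobi, ee_zero, add_comm]
  · simp [jacobi, h2, add_comm]
  · norm_num [jacobi, ee_zero, h3]
  · norm_num [jacobi, ee_half, h3]
    ring

theorem jacobi_S (a b : Fin 2) {τ : ℂ} (hτ : 0 < τ.im) (z : ℂ) :
    jacobi a b (-1 / τ) (z / τ) = (-I) ^ (a.val * b.val) * (-I * τ) ^ (1 / 2 : ℂ)
      * ee (z ^ 2 / (2 * τ)) * jacobi b a τ z := by
  have h0 : τ ≠ 0 := fun h => by simp [h] at hτ
  have hR : (-I * τ) ^ (1 / 2 : ℂ) ≠ 0 := by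
    rw [Complex.cpow_ne_zero_iff]; left; simp [h0]
  rw [jacobi_eq a b (im_neg_one_div_pos hτ), jacobi_eq b a hτ]
  set ζ : ℂ := z - a.val / 2 + b.val * τ / 2 with hζ
  have h1 := jacobiTheta₂_functional_equation ζ τ
  have e1 : z / τ + a.val * (-1 / τ) / 2 + b.val / 2 = ζ / τ := by
    rw [hζ]; field_simp; ring
  have e2 : jacobiTheta₂ ζ τ = jacobiTheta₂ (z + b.val * τ / 2 + a.val / 2) τ := by
    have e : z + b.val * τ / 2 + a.val / 2 = ζ + a.val := by rw [hζ]; ring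
    rw [e]
    rcases (show a.val = 0 ∨ a.val = 1 by omega) with h | h <;> rw [h]
    · simp
    · rw [Nat.cast_one, jacobiTheta₂_add_left]
  have h2 : jacobiTheta₂ (ζ / τ) (-1 / τ) = (-I * τ) ^ (1 / 2 : ℂ) * ee (ζ ^ 2 / (2 * τ))
      * jacobiTheta₂ ζ τ := by
    have e3 : cexp (-π * I * ζ ^ 2 / τ) = (ee (ζ ^ 2 / (2 * τ)))⁻¹ := by
      rw [← ee_neg, ee]; congr 1; field_simp
    rw [h1, e3]
    have := ee_ne_zero (ζ ^ 2 / (2 * τ))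
    generalize ee (ζ ^ 2 / (2 * τ)) = x at this
    generalize jacobiTheta₂ _ _ = J
    field_simp
  rw [e1, h2, e2, mul_comm b.val a.val]
  generalize jacobiTheta₂ _ _ = J
  have hq : (-I) ^ (a.val * b.val) = ee (-(a.val * b.val / 4)) := by
    rw [← ee_neg_quarter, ← ee_nat_mul]; congr 1; push_cast; ring
  have key : ee (a.val ^ 2 * (-1 / τ) / 8 + a.val * (z / τ) / 2) * ee (ζ ^ 2 / (2 * τ))
      = ee (-(a.val * b.val / 4)) * ee (z ^ 2 / (2 * τ)) * ee (b.val ^ 2 * τ / 8 + b.val * z / 2) := by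
    rw [← ee_add, ← ee_add, ← ee_add]
    congr 1
    rw [hζ]
    field_simp
    ring
  rw [hq]
  linear_combination (I ^ (a.val * b.val) * (-I * τ) ^ (1 / 2 : ℂ) * J) * key

/-- `N² ≡ N` mod 2, so the phase `ee (N²/2)` is `ee (N/2)`. -/
theorem jacobiTheta₂_add_one (ζ τ : ℂ) :
    jacobiTheta₂ ζ (τ + 1) = jacobiTheta₂ (ζ + 1 / 2) τ := by
  rw [jacobiTheta₂_eq_tsum_ee, jacobiTheta₂_eq_tsum_ee]
  refine tsum_congr fun N => ?_
  obtain ⟨k, hk⟩ := Int.even_or_odd' (N * (N - 1))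
  have hk' : N * (N - 1) = 2 * k := by
    rcases hk with h | h
    · exact h
    · exact absurd (Int.even_mul_pred_self N) (by rw [h]; simp)
  have hkC : (N : ℂ) * (N - 1) = 2 * k := by exact_mod_cast hk'
  exact ee_congr k (by linear_combination hkC / 2)

theorem jacobi_zero_add_one (b : Fin 2) {τ : ℂ} (hτ : 0 < τ.im) (z : ℂ) :
    jacobi 0 b (τ + 1) z = jacobi 0 (b + 1) τ z := by
  rw [jacobi_eq 0 b (by simpa using hτ), jacobi_eq 0 (b + 1) hτ, jacobiTheta₂_add_one]
  have h : jacobiTheta₂ (z + 1 / 2 + 1 / 2) τ = jacobiTheta₂ z τ := by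
    rw [add_assoc, add_halves, jacobiTheta₂_add_left]
  fin_cases b
  · simp
  · simpa [ee_zero] using h

theorem jacobi_one_add_one (b : Fin 2) {τ : ℂ} (hτ : 0 < τ.im) (z : ℂ) :
    jacobi 1 b (τ + 1) z = ee (1 / 8) * jacobi 1 b τ z := by
  rw [jacobi_eq 1 b (by simpa using hτ), jacobi_eq 1 b hτ, jacobiTheta₂_add_one]
  have h : z + (1 : Fin 2).val * (τ + 1) / 2 + b.val / 2 + 1 / 2
      = z + (1 : Fin 2).val * τ / 2 + b.val / 2 + 1 := by
    simp; ring
  rw [h, jacobiTheta₂_add_left]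
  have h2 : ee ((1 : Fin 2).val ^ 2 * (τ + 1) / 8 + (1 : Fin 2).val * z / 2)
      = ee (1 / 8) * ee ((1 : Fin 2).val ^ 2 * τ / 8 + (1 : Fin 2).val * z / 2) := by
    rw [← ee_add]; congr 1; simp; ring
  rw [h2]
  ring

theorem eta_add_one (τ : ℂ) :
    ModularForm.eta (τ + 1) = ee (1 / 24) * ModularForm.eta τ := by
  have h1 : ∀ n : ℕ, ModularForm.eta_q n (τ + 1) = ModularForm.eta_q n τ := by
    intro n
    rw [ModularForm.eta_q_eq_cexp, ModularForm.eta_q_eq_cexp]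
    have := ee_congr (x := (n + 1) * (τ + 1)) (y := (n + 1) * τ) (n + 1) (by push_cast; ring)
    simpa only [ee, mul_assoc] using this
  have h2 : Function.Periodic.qParam 24 (τ + 1) = ee (1 / 24) * Function.Periodic.qParam 24 τ := by
    rw [Function.Periodic.qParam, Function.Periodic.qParam, ee, ← Complex.exp_add]
    congr 1; push_cast; ring
  simp only [ModularForm.eta, h1, h2, mul_assoc]

theorem eta_S {τ : ℂ} (hτ : 0 < τ.im) :
    ModularForm.eta (-1 / τ) = (-I * τ) ^ (1 / 2 : ℂ) * ModularForm.eta τ := by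
  have h0 : τ ≠ 0 := fun h => by simp [h] at hτ
  have h := ModularForm.eta_comp_eq_csqrt_I_inv (show τ ∈ UpperHalfPlane.upperHalfPlaneSet from hτ)
  simp only [Function.comp, Pi.smul_apply, Pi.mul_apply, smul_eq_mul] at h
  rw [h, ← mul_assoc]
  congr 1
  have hre : 0 < (-I * τ).re := by simpa using hτ
  have harg := abs_lt.mp (Complex.abs_arg_lt_pi_div_two_iff.mpr (Or.inl hre))
  have hIτ : -I * τ ≠ 0 := by simp [h0]
  -- For `τ` in the upper half plane `-iτ` has positive real part, so adding `arg I = π/2` stays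
  -- within the principal branch and the square roots are compatible.
  have hlog : Complex.log (I * (-I * τ)) = Complex.log I + Complex.log (-I * τ) := by
    rw [Complex.log_mul_eq_add_log_iff Complex.I_ne_zero hIτ, Complex.arg_I]
    constructor <;> linarith [harg.1, harg.2]
  have hmul : I * (-I * τ) = τ := by linear_combination (-τ) * Complex.I_sq
  rw [hmul] at hlog
  rw [Complex.sqrt, Complex.sqrt, Complex.cpow_def_of_ne_zero h0,
    Complex.cpow_def_of_ne_zero Complex.I_ne_zero, Complex.cpow_def_of_ne_zero hIτ, hlog,
    ← Complex.exp_neg, ← Complex.exp_add]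
  congr 1
  ring

/-! ### The characters -/

theorem chTilde_eq (M m : ℕ) (e e' : Fin 2) (j k : ℚ) (τ z : ℂ) :
    chTilde M m e e' j k τ z = PsiTilde M m e j k τ (-z) z 0 * jacobi (1 - e') (1 - e) τ z
      / ((-1) ^ ((1 - e).val * (1 - e').val) * ModularForm.eta τ ^ 3) := by
  rw [chTilde, denom, div_div_eq_mul_div]

theorem chTilde_S (M m : ℕ) (hM : 0 < M) (hnM : Nat.Coprime (m + 1) M) (e e' : Fin 2) (p : ℚ × ℚ)
    (hp : p ∈ Omega M e') {τ z : ℂ} (hτ : 0 < τ.im) (hz : IsRegular e' e τ z) :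
    chTilde M m e e' p.1 p.2 (-1 / τ) (z / τ) =
      Complex.exp (π * I * centralCharge M m / (3 * τ) * z ^ 2) *
        ∑ r ∈ Omega M e, Smatrix M m e e' p r * chTilde M m e' e r.1 r.2 τ z := by
  have h0 : τ ≠ 0 := fun h => by simp [h] at hτ
  have hMC : (M : ℂ) ≠ 0 := Nat.cast_ne_zero.mpr hM.ne'
  obtain ⟨⟨a, b, ha, hb⟩, -⟩ := (mem_Omega M e' p).mp hp
  have hη : ModularForm.eta τ ≠ 0 := ModularForm.eta_ne_zero hτ
  have hR : (-I * τ) ^ (1 / 2 : ℂ) ≠ 0 := by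
    rw [Complex.cpow_ne_zero_iff]; left; simp [h0]
  have hR2 : (-I * τ) ^ (1 / 2 : ℂ) * (-I * τ) ^ (1 / 2 : ℂ) = -I * τ := by
    rw [← Complex.cpow_add _ _ (by simp [h0] : -I * τ ≠ 0)]
    norm_num
  have hexp : Complex.exp (π * I * centralCharge M m / (3 * τ) * z ^ 2)
      = ee (z ^ 2 / (2 * τ)) * ee (-((m + 1) * z ^ 2 / (M * τ))) := by
    rw [← ee_add, ee, centralCharge]
    congr 1
    field_simp
    ring
  rw [chTilde_eq, PsiTilde_S_Omega M m e e' hM hnM hτ hz a b p.1 p.2 (by rw [ha]; simp)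
    (by rw [hb]; simp), jacobi_S _ _ hτ, eta_S hτ, hexp]
  simp only [chTilde_eq, Smatrix]
  rw [mul_comm (1 - e').val (1 - e).val]
  generalize (-I * τ) ^ (1 / 2 : ℂ) = R at hR hR2
  generalize jacobi (1 - e) (1 - e') τ z = J
  have hterm : ∀ r ∈ Omega M e,
      (-I) ^ ((1 - e).val * (1 - e').val) * (2 / M)
        * Complex.exp (π * I * (m + 1) / M * (p.1 - p.2) * (r.1 - r.2))
        * Complex.sin ((m + 1) / M * (p.1 + p.2) * (r.1 + r.2) * π)
        * (PsiTilde M m e' r.1 r.2 τ (-z) z 0 * J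
          / ((-1) ^ ((1 - e).val * (1 - e').val) * ModularForm.eta τ ^ 3))
      = (-I) ^ ((1 - e).val * (1 - e').val) * (2 / M) * J
          / ((-1) ^ ((1 - e).val * (1 - e').val) * ModularForm.eta τ ^ 3)
        * (Complex.exp (π * I * (m + 1) / M * (p.1 - p.2) * (r.1 - r.2))
          * Complex.sin ((m + 1) / M * (p.1 + p.2) * (r.1 + r.2) * π)
          * PsiTilde M m e' r.1 r.2 τ (-z) z 0) := by
    intro r _
    ring
  rw [Finset.sum_congr rfl hterm, ← Finset.mul_sum]
  generalize (∑ r ∈ Omega M e, _ : ℂ) = S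
  -- `η³` contributes `R³ = R·(-iτ)` with `R = (-iτ)^{1/2}`. The factor `R` cancels against the
  -- theta function, and `-iτ` turns the `-2iτ/M` of the numerator into `2/M`.
  have hR3 : (R * ModularForm.eta τ) ^ 3 = R * (-I * τ) * ModularForm.eta τ ^ 3 := by
    rw [← hR2]; ring
  rw [hR3]
  have hs : ((-1 : ℂ)) ^ ((1 - e).val * (1 - e').val) ≠ 0 := pow_ne_zero _ (by norm_num)
  generalize ((-1 : ℂ)) ^ ((1 - e).val * (1 - e').val) = σ at hs
  generalize (-I) ^ ((1 - e).val * (1 - e').val) = κ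
  generalize ee (z ^ 2 / (2 * τ)) = u
  generalize ee (-((m + 1) * z ^ 2 / (M * τ))) = t
  have hI := Complex.I_ne_zero
  field_simp

theorem exists_half_add (e e' : Fin 2) :
    ∃ κ : ℤ, (half e : ℂ) + half e' = half (e + e') + κ := by
  fin_cases e <;> fin_cases e'
  · exact ⟨0, by simp [half]⟩
  · exact ⟨0, by simp [half]⟩
  · exact ⟨0, by simp [half]⟩
  · exact ⟨1, by norm_num [half]⟩

theorem PsiTilde_T (M m : ℕ) (hM : 0 < M) (e e' : Fin 2) {τ z : ℂ} (hτ : 0 < τ.im)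
    (hz : IsRegular (e + e') e' τ z) (j₀ k₀ : ℤ) :
    PsiTilde M m e (half e' + j₀) (half e' + k₀) (τ + 1) (-z) z 0
      = ee ((m + 1) / M * (half e' + j₀) * (half e' + k₀))
        * PsiTilde M m (e + e') (half e' + j₀) (half e' + k₀) τ (-z) z 0 := by
  have hM' : (0 : ℝ) < M := Nat.cast_pos.mpr hM
  have himM : 0 < (M * τ).im := by
    rw [← Complex.ofReal_natCast, Complex.im_ofReal_mul]; positivity
  obtain ⟨κ, hκ⟩ := exists_half_add e e'
  have h1 := (hz.off_neg j₀).mul M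
  have h2 := (hz.off k₀).mul M
  have hint := PhiTilde_add_int m himM h1 h2 (j₀ + κ) (k₀ + κ)
  have h1' := h1.add (j₀ + κ) 0
  have h2' := h2.add (k₀ + κ) 0
  simp only [Int.cast_zero, zero_mul, add_zero] at h1' h2'
  have hT := PhiTilde_add_tau m himM h1' h2' M
  rw [hint] at hT
  have e0 : (M : ℂ) * (τ + 1) = M * τ + (M : ℤ) := by push_cast; ring
  have e1 : -z + ((half e' + j₀ : ℚ) : ℂ) * (τ + 1) + half e
      = -z + ((half e' + j₀ : ℚ) : ℂ) * τ + half (e + e') + (j₀ + κ : ℤ) := by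
    push_cast; linear_combination hκ
  have e2 : z + ((half e' + k₀ : ℚ) : ℂ) * (τ + 1) + half e
      = z + ((half e' + k₀ : ℚ) : ℂ) * τ + half (e + e') + (k₀ + κ : ℤ) := by
    push_cast; linear_combination hκ
  simp only [PsiTilde, zero_div]
  rw [e0, e1, e2, hT]
  simp only [qpow_eq_ee, ← mul_assoc, ← ee_add]
  congr 2
  push_cast
  ring

theorem chTilde_T (M m : ℕ) (hM : 0 < M) (e e' : Fin 2) (p : ℚ × ℚ)
    (hp : p ∈ Omega M e') {τ z : ℂ} (hτ : 0 < τ.im) (hz : IsRegular (e + e') e' τ z) :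
    chTilde M m e e' p.1 p.2 (τ + 1) z =
      Complex.exp (2 * π * I * (m + 1) / M * p.1 * p.2 - π * I * half e' / 2)
        * chTilde M m (e + e') e' p.1 p.2 τ z := by
  obtain ⟨⟨a, b, ha, hb⟩, -⟩ := (mem_Omega M e' p).mp hp
  have hη : ModularForm.eta τ ≠ 0 := ModularForm.eta_ne_zero hτ
  have hΨ := PsiTilde_T M m hM e e' hτ hz a b
  simp only [Int.cast_natCast] at hΨ
  have hexp : Complex.exp (2 * π * I * (m + 1) / M * p.1 * p.2 - π * I * half e' / 2)
      = ee ((m + 1) / M * (half e' + a) * (half e' + b)) * ee (-(half e' / 4)) := by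
    rw [← ee_add, ee, ha, hb]
    congr 1
    push_cast
    ring
  rw [chTilde_eq, chTilde_eq, eta_add_one, hexp, ha, hb, hΨ]
  have h24 : ee (1 / 24) ^ 3 = ee (1 / 8) := by
    rw [← ee_nat_mul]; congr 1; norm_num
  rw [mul_pow, h24]
  generalize PsiTilde M m (e + e') _ _ τ (-z) z 0 = P
  have h8 := ee_ne_zero (1 / 8)
  -- In the Ramond case the theta function acquires the same `ee (1/8)` as `η³` and they cancel. In
  -- the Neveu–Schwarz case only `η³` does, leaving `ee (-1/8) = e^{-πi/4}`.
  rcases (show e' = 0 ∨ e' = 1 by omega) with rfl | rfl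
  · have hh : ee (-((half 0 : ℚ) / 4 : ℂ)) = 1 := by rw [← ee_zero]; simp [half]
    rw [sub_zero, jacobi_one_add_one _ hτ, hh, add_zero]
    have hs : ((-1 : ℂ)) ^ ((1 - e).val * (1 : Fin 2).val) ≠ 0 := pow_ne_zero _ (by norm_num)
    generalize ((-1 : ℂ)) ^ ((1 - e).val * (1 : Fin 2).val) = σ at hs
    field_simp
  · have hh : ee (-((half 1 : ℚ) / 4 : ℂ)) = (ee (1 / 8))⁻¹ := by
      rw [← ee_neg]; congr 1; norm_num [half]
    have hf : 1 - e + 1 = 1 - (e + 1) := by fin_cases e <;> rfl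
    rw [sub_self, jacobi_zero_add_one _ hτ, hh, hf]
    simp only [Fin.val_zero, mul_zero, pow_zero, one_mul]
    field_simp

end

end N2Characters

theorem theorem9p2 (M m : ℕ) (hM : 2 ≤ M) (hMm : 0 < m → Nat.gcd M (2 * m + 2) = 1)
    (e e' : Fin 2) (p : ℚ × ℚ) (hp : p ∈ N2Characters.Omega M e')
    (τ z : ℂ) (hτ : 0 < τ.im) :
    (N2Characters.IsRegular e' e τ z →
      N2Characters.chTilde M m e e' p.1 p.2 (-1 / τ) (z / τ) =
        Complex.exp (Real.pi * Complex.I * N2Characters.centralCharge M m / (3 * τ) * z ^ 2) *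
          ∑ r ∈ N2Characters.Omega M e,
            N2Characters.Smatrix M m e e' p r * N2Characters.chTilde M m e' e r.1 r.2 τ z) ∧
    (N2Characters.IsRegular (e + e') e' τ z →
      N2Characters.chTilde M m e e' p.1 p.2 (τ + 1) z =
        Complex.exp (2 * Real.pi * Complex.I * (m + 1) / M * p.1 * p.2
            - Real.pi * Complex.I * N2Characters.half e' / 2) *
          N2Characters.chTilde M m (e + e') e' p.1 p.2 τ z) := by
  have hM0 : 0 < M := by omega
  have hnM : Nat.Coprime (m + 1) M := by
    -- Only coprimality of `m + 1` and `M` matters. It is automatic for `m = 0`.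
    rcases Nat.eq_zero_or_pos m with rfl | hm
    · simp
    · exact (Nat.Coprime.coprime_dvd_right ⟨2, by ring⟩ (hMm hm)).symm
  exact ⟨N2Characters.chTilde_S M m hM0 hnM e e' p hp hτ,
    N2Characters.chTilde_T M m hM0 e e' p hp hτ⟩
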